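/- Let $(A,I)$ be a finite independence alphabet, i.e. a finite set $A$ with a symmetric anti-reflexive relation $I$, let $\Gamma(A,I)$ be the simple graph with vertex set $A$ and edge set $I$, and let $M(A,I)=\langle A \mid ab=ba\ ((a,b)\in I)\rangle$ be the trace monoid. A clique is a nonempty set $B\subseteq A$ of pairwise adjacent vertices of $\Gamma(A,I)$; $w_B\in M(A,I)$ denotes the product of its letters. A real trace is a finite or infinite sequence $w_{B_1}w_{B_2}\cdots$ (a Foata normal form) of cliques such that for all $i\ge 2$ and $a\in B_i$ there is $b\in B_{i-1}$ with $(a,b)\notin I$. Let $\hat M(A,I)$ be the set of real traces. Each element of $M(A,I)$ is the product of exactly one finite Foata normal form, so $M(A,I)$ is identified with the set of finite real traces; $\partial M(A,I)$ is the set of infinite ones. On $\hat M(A,I)$ let $d(X,X)=0$ and, for $X\ne Y$, $d(X,Y)=2^{-r}$, where $r$ is the largest $k\ge 0$ such that $X$ and $Y$ both have at least $k$ factors and their first $k$ factors coincide. The metric space $(\hat M(A,I),d)$ is the completion of $(M(A,I),d)$; every endomorphism $\varphi$ of $M(A,I)$ that is uniformly continuous with respect to $d$ has a unique continuous extension $\Phi:\hat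 M(A,I)\to\hat M(A,I)$, and the mixed product of $u\in M(A,I)$ and $X=\lim_n v_n\in\partial M(A,I)$ ($v_n\in M(A,I)$) is $uX=\lim_n uv_n$. Write $\mathrm{Fix}$ for the set of fixed points and an overline for the closure in $(\hat M(A,I),d)$. A set $Y\subseteq\hat M(A,I)$ is mp-rational if it can be obtained from finite subsets of $\hat M(A,I)$ by applying finitely many times union, the product $KL$ and the star $K^*$ (the submonoid generated by $K$) of subsets $K,L$ of $M(A,I)$, and the mixed product $KZ=\{uX : u\in K,\ X\in Z\}$ of $K\subseteq M(A,I)$ with $Z\subseteq\partial M(A,I)$. Suppose that $\Gamma(A,I)$ is of type T, i.e. none of its induced subgraphs is isomorphic to the path on four vertices, to the cycle on four vertices, or to the graph with vertices $a,b,c,x,y$ and edges $ab$, $bx$, $ay$, $by$, $bc$, $yc$. Then the following conditions are equivalent: (i) for every endomorphism $\varphi$ of $M(A,I)$ that is uniformly continuous with respect to $d$, there exists an mp-rational $Y\subseteq\hat M(A,I)$ such that $\mathrm{Fix}\,\Phi=\overline{\mathrm{Fix}\,\varphi}\cup Y$; (ii) $I\cup\Delta_A$ is transitive, where $\Delta_A=\{(a,a)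 : a\in A\}$; (iii) $\Gamma(A,I)$ is a disjoint union of complete graphs; (iv) $M(A,I)$ is (isomorphic to) a free product of finitely many free commutative monoids of finite rank. -/

import Mathlib

open scoped SimpleGraph

/-!
An independence alphabet `(A, I)` (a set `A` with a symmetric, anti-reflexive relation `I`) is the
same thing as a simple graph `G` on `A`, with `I = G.Adj`; then `G` is the graph `Γ(A, I)`.
-/

/-- The defining relations `ab = ba`, `(a, b) ∈ I`, of a trace monoid. -/
inductive TraceRel {A : Type*} (G : SimpleGraph A) : FreeMonoid A → FreeMonoid A → Prop
  | swap {a b : A} (h : G.Adj a b) :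
      TraceRel G (FreeMonoid.of a * FreeMonoid.of b) (FreeMonoid.of b * FreeMonoid.of a)

/-- The trace monoid `M(A, I) = ⟨A ∣ ab = ba ((a, b) ∈ I)⟩`. -/
def TraceMonoid {A : Type*} (G : SimpleGraph A) : Type _ := PresentedMonoid (TraceRel G)

noncomputable instance {A : Type*} (G : SimpleGraph A) : Monoid (TraceMonoid G) :=
  inferInstanceAs (Monoid (PresentedMonoid (TraceRel G)))

namespace TraceMonoid

/-- The quotient map from words to traces. -/
def ofWord {A : Type*} (G : SimpleGraph A) : FreeMonoid A →* TraceMonoid G :=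
  PresentedMonoid.mk (TraceRel G)

/-- A letter, as an element of the trace monoid. -/
def of {A : Type*} (G : SimpleGraph A) (a : A) : TraceMonoid G :=
  PresentedMonoid.of (TraceRel G) a

theorem of_commute {A : Type*} {G : SimpleGraph A} {a b : A} (h : G.Adj a b) :
    Commute (of G a) (of G b) :=
  PresentedMonoid.mk_eq_mk_of_rel (TraceRel.swap h)

/-- A finite set of pairwise independent letters (a clique, or the empty set). -/
theorem pairwise_commute {A : Type*} {G : SimpleGraph A} {B : Finset A}
    (hB : G.IsClique (B : Set A)) :
    (B : Set A).Pairwise (Function.onFun Commute (of G)) :=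
  fun _ ha _ hb hab => of_commute (hB ha hb hab)

/-- `w_B`, the product of all the letters of a clique `B` (and `1` if `B` is empty). -/
noncomputable def cliqueProd {A : Type*} (G : SimpleGraph A) (B : Finset A)
    (hB : G.IsClique (B : Set A)) : TraceMonoid G :=
  B.noncommProd (of G) (pairwise_commute hB)

end TraceMonoid

/-- A real trace on `(A, I)`: a finite or infinite Foata normal form `w_{B_1} w_{B_2} ⋯`. It is
stored as the sequence of its cliques (`block n` is `B_{n+1}`), where a finite normal form with `k`
factors is continued by empty blocks from index `k` on. The condition `foata` forces all the blocks
that follow an empty block to be empty, so a real trace either consists of cliques only or is a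
finite sequence of cliques followed by empty blocks. -/
@[ext]
structure RealTrace {A : Type*} (G : SimpleGraph A) where
  block : ℕ → Finset A
  isClique : ∀ n, G.IsClique (block n : Set A)
  foata : ∀ n, ∀ a ∈ block (n + 1), ∃ b ∈ block n, ¬ G.Adj a b

namespace RealTrace

/-- The Foata normal form is finite. -/
def IsFinite {A : Type*} {G : SimpleGraph A} (X : RealTrace G) : Prop :=
  ∃ N, ∀ n ≥ N, X.block n = ∅

/-- The boundary `∂M(A, I)`: the infinite real traces. -/
def boundary {A : Type*} (G : SimpleGraph A) : Set (RealTrace G) := {X | ¬ X.IsFinite}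

/-- The element `w_{B_1} ⋯ w_{B_n}` of the trace monoid. -/
noncomputable def pre {A : Type*} {G : SimpleGraph A} (X : RealTrace G) : ℕ → TraceMonoid G
  | 0 => 1
  | n + 1 => X.pre n * TraceMonoid.cliqueProd G (X.block n) (X.isClique n)

/-- `X` is a (finite) Foata normal form of the element `u` of the trace monoid. -/
def IsFoataOf {A : Type*} {G : SimpleGraph A} (X : RealTrace G) (u : TraceMonoid G) : Prop :=
  ∃ N, (∀ n ≥ N, X.block n = ∅) ∧ X.pre N = u

theorem block_injective {A : Type*} {G : SimpleGraph A} :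
    Function.Injective (RealTrace.block (G := G)) := fun _ _ h => RealTrace.ext h

/-- The ultrametric `d(X, Y) = 2^{-r(X, Y)}`, where `r(X, Y)` is, for `X ≠ Y`, the number of initial
blocks in which `X` and `Y` agree before they first differ, and `d(X, X) = 0`. -/
noncomputable instance {A : Type*} (G : SimpleGraph A) : Dist (RealTrace G) :=
  ⟨fun X Y => open Classical in
    if X = Y then 0 else (1 / 2 : ℝ) ^ PiNat.firstDiff X.block Y.block⟩

theorem dist_def {A : Type*} {G : SimpleGraph A} (X Y : RealTrace G) :
    dist X Y = PiNat.dist.dist X.block Y.block := by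
  classical
  by_cases h : X = Y
  · subst h
    rw [PiNat.dist_self]
    exact if_pos rfl
  · rw [PiNat.dist_eq_of_ne (block_injective.ne h)]
    exact if_neg h

noncomputable instance {A : Type*} (G : SimpleGraph A) : MetricSpace (RealTrace G) where
  dist_self X := by rw [dist_def]; exact PiNat.dist_self _
  dist_comm X Y := by rw [dist_def, dist_def]; exact PiNat.dist_comm _ _
  dist_triangle X Y Z := by
    rw [dist_def, dist_def, dist_def]; exact PiNat.dist_triangle _ _ _
  eq_of_dist_eq_zero {X Y} h := by
    rw [dist_def] at h
    exact block_injective (PiNat.eq_of_dist_eq_zero _ _ h)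

end RealTrace

/-! ### Existence and uniqueness of the Foata normal form -/

namespace RealTrace

/-- The block in which a new last letter `a` is to be placed. -/
noncomputable def height {A : Type*} {G : SimpleGraph A} (X : RealTrace G) (a : A) : ℕ :=
  sInf {n | ∀ m ≥ n, ∀ b ∈ X.block m, G.Adj a b}

theorem height_spec {A : Type*} {G : SimpleGraph A} {X : RealTrace G} (hX : X.IsFinite) (a : A) :
    ∀ m ≥ X.height a, ∀ b ∈ X.block m, G.Adj a b := by
  have : {n | ∀ m ≥ n, ∀ b ∈ X.block m, G.Adj a b}.Nonempty := by
    obtain ⟨N, hN⟩ := hX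
    refine ⟨N, fun m hm b hb => ?_⟩
    simp [hN m hm] at hb
  exact Nat.sInf_mem this

theorem height_le {A : Type*} {G : SimpleGraph A} {X : RealTrace G} {a : A} {n : ℕ}
    (h : ∀ m ≥ n, ∀ b ∈ X.block m, G.Adj a b) : X.height a ≤ n := Nat.sInf_le h

theorem exists_of_height {A : Type*} {G : SimpleGraph A} {X : RealTrace G} (hX : X.IsFinite)
    {a : A} {n : ℕ} (h : X.height a = n + 1) : ∃ b ∈ X.block n, ¬ G.Adj a b := by
  by_contra hc
  push Not at hc
  have : X.height a ≤ n := by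
    apply height_le
    intro m hm
    rcases hm.eq_or_lt with rfl | hm
    · exact hc
    · exact height_spec hX a m (by omega)
  omega

open Classical in
/-- Multiplication of a finite normal form by a letter on the right. -/
noncomputable def ins {A : Type*} {G : SimpleGraph A} (a : A)
    (X : {X : RealTrace G // X.IsFinite}) : {X : RealTrace G // X.IsFinite} :=
  ⟨{ block := fun n => if n = X.1.height a then insert a (X.1.block n) else X.1.block n
     isClique := by
      intro n
      split_ifs with h
      · rw [Finset.coe_insert]
        exact (X.1.isClique n).insert fun b hb _ => height_spec X.2 a n h.ge b hb
      · exact X.1.isClique n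
     foata := by
      intro n c hc
      have key : ∃ b ∈ X.1.block n, ¬ G.Adj c b := by
        split_ifs at hc with h
        · rcases Finset.mem_insert.1 hc with rfl | hc
          · exact exists_of_height X.2 h.symm
          · exact X.1.foata n c hc
        · exact X.1.foata n c hc
      obtain ⟨b, hb, hcb⟩ := key
      refine ⟨b, ?_, hcb⟩
      split_ifs
      · exact Finset.mem_insert_of_mem hb
      · exact hb }, by
    obtain ⟨N, hN⟩ := X.2
    refine ⟨max N (X.1.height a + 1), fun n hn => ?_⟩
    have h1 : N ≤ n := le_trans (le_max_left _ _) hn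
    have h2 : X.1.height a + 1 ≤ n := le_trans (le_max_right _ _) hn
    have h3 : n ≠ X.1.height a := by omega
    simp only [if_neg h3]
    exact hN n h1⟩

theorem height_ins {A : Type*} {G : SimpleGraph A} {a b : A} (h : G.Adj a b)
    (X : {X : RealTrace G // X.IsFinite}) : (ins a X).1.height b = X.1.height b := by
  classical
  unfold height
  congr 1
  ext n
  refine forall_congr' fun m => forall_congr' fun _ => ?_
  simp only [ins]
  split_ifs
  · simp [h.symm]
  · rfl

theorem ins_comm {A : Type*} {G : SimpleGraph A} {a b : A} (h : G.Adj a b)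
    (X : {X : RealTrace G // X.IsFinite}) : ins b (ins a X) = ins a (ins b X) := by
  classical
  apply Subtype.ext
  apply RealTrace.ext
  funext n
  have h1 := height_ins h X
  have h2 := height_ins h.symm X
  change (if n = (ins a X).1.height b then insert b ((ins a X).1.block n)
      else (ins a X).1.block n) = (if n = (ins b X).1.height a then insert a ((ins b X).1.block n)
      else (ins b X).1.block n)
  rw [h1, h2]
  simp only [ins]
  split_ifs <;> first | rfl | exact Finset.insert_comm _ _ _

/-- The right action of the trace monoid on its finite normal forms. -/
noncomputable def act {A : Type*} (G : SimpleGraph A) :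
    TraceMonoid G →* (Function.End {X : RealTrace G // X.IsFinite})ᵐᵒᵖ :=
  PresentedMonoid.lift (rels := TraceRel G)
    (M := (Function.End {X : RealTrace G // X.IsFinite})ᵐᵒᵖ)
    (fun a => MulOpposite.op (ins a)) (by
    rintro _ _ ⟨h⟩
    simp only [map_mul, FreeMonoid.lift_eval_of]
    exact congrArg MulOpposite.op (funext fun X => ins_comm h X))

theorem act_of {A : Type*} (G : SimpleGraph A) (a : A) (X : {X : RealTrace G // X.IsFinite}) :
    (act G (TraceMonoid.of G a)).unop X = ins a X := rfl

theorem act_mul {A : Type*} (G : SimpleGraph A) (u v : TraceMonoid G)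
    (X : {X : RealTrace G // X.IsFinite}) :
    (act G (u * v)).unop X = (act G v).unop ((act G u).unop X) := by
  rw [map_mul]; rfl

/-- The empty normal form. -/
def nil {A : Type*} (G : SimpleGraph A) : {X : RealTrace G // X.IsFinite} :=
  ⟨⟨fun _ => ∅, by simp, by simp⟩, ⟨0, fun _ _ => rfl⟩⟩

theorem isFoataOf_ins {A : Type*} {G : SimpleGraph A} {a : A}
    {X : {X : RealTrace G // X.IsFinite}} {u : TraceMonoid G} (h : X.1.IsFoataOf u) :
    (ins a X).1.IsFoataOf (u * TraceMonoid.of G a) := by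
  classical
  obtain ⟨N, hN, hu⟩ := h
  have hle : X.1.height a ≤ N := height_le fun m hm b hb => by simp [hN m hm] at hb
  have hblock : ∀ n, (ins a X).1.block n =
      if n = X.1.height a then insert a (X.1.block n) else X.1.block n := fun n => rfl
  have hcongr : ∀ {B C : Finset A} (hB : G.IsClique (B : Set A)) (hC : G.IsClique (C : Set A)),
      B = C → TraceMonoid.cliqueProd G B hB = TraceMonoid.cliqueProd G C hC := by
    rintro B _ hB hC rfl; rfl
  have h1 : ∀ n ≤ X.1.height a, (ins a X).1.pre n = X.1.pre n := by
    intro n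
    induction n with
    | zero => intro _; rfl
    | succ n ih =>
      intro hn
      have : n ≠ X.1.height a := by omega
      simp only [pre]
      rw [ih (by omega), hcongr _ (X.1.isClique n) (by rw [hblock, if_neg this])]
  have h2 : ∀ k, (ins a X).1.pre (X.1.height a + 1 + k) =
      X.1.pre (X.1.height a + 1 + k) * TraceMonoid.of G a := by
    intro k
    induction k with
    | zero =>
      simp only [pre]
      have hnot : a ∉ X.1.block (X.1.height a) := fun hmem =>
        G.loopless.irrefl a (height_spec X.2 a _ le_rfl a hmem)
      have hcl : G.IsClique ((insert a (X.1.block (X.1.height a)) : Finset A) : Set A) := by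
        have := (ins a X).1.isClique (X.1.height a)
        rwa [hblock, if_pos rfl] at this
      rw [h1 _ le_rfl, hcongr _ hcl (by rw [hblock, if_pos rfl]), mul_assoc]
      congr 1
      exact Finset.noncommProd_insert_of_notMem' _ _ _ _ hnot
    | succ k ih =>
      have hne : X.1.height a + 1 + k ≠ X.1.height a := by omega
      rw [← Nat.add_assoc]
      simp only [pre]
      rw [ih, hcongr _ (X.1.isClique _) (by rw [hblock, if_neg hne]), mul_assoc, mul_assoc]
      congr 1
      apply Finset.noncommProd_commute
      intro b hb
      exact TraceMonoid.of_commute (height_spec X.2 a _ (by omega) b hb)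
  refine ⟨N + 1, fun n hn => ?_, ?_⟩
  · rw [hblock, if_neg (by omega), hN n (by omega)]
  · obtain ⟨k, hk⟩ := Nat.exists_eq_add_of_le hle
    have : N + 1 = X.1.height a + 1 + k := by omega
    rw [this, h2, ← this]
    congr 1
    simp only [pre]
    rw [hu, hcongr (C := ∅) _ (by simp) (hN N le_rfl)]
    simp [TraceMonoid.cliqueProd]

theorem isFoataOf_act {A : Type*} {G : SimpleGraph A} (u : TraceMonoid G) :
    ((act G u).unop (nil G)).1.IsFoataOf u := by
  have key : ∀ (w : FreeMonoid A) (X : {X : RealTrace G // X.IsFinite}) (v : TraceMonoid G),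
      X.1.IsFoataOf v →
      ((act G (TraceMonoid.ofWord G w)).unop X).1.IsFoataOf
        (v * (TraceMonoid.ofWord G w)) := by
    intro w
    induction w using FreeMonoid.inductionOn' with
    | one =>
      intro X v h
      rw [map_one]
      exact (mul_one v).symm ▸ h
    | of_mul a w ih =>
      intro X v h
      have h' := ih (ins a X) _ (isFoataOf_ins (a := a) h)
      rw [mul_assoc] at h'
      rw [map_mul, act_mul]
      exact h'
  obtain ⟨w, rfl⟩ := PresentedMonoid.surjective_mk u
  have := key w (nil G) 1 ⟨0, fun _ _ => rfl, rfl⟩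
  rwa [one_mul] at this

/-- The truncation of `X` that keeps the first `n` blocks and part of the next one. -/
noncomputable def cut {A : Type*} {G : SimpleGraph A} (X : RealTrace G) (n : ℕ) (S : Finset A)
    (hS : S ⊆ X.block n) : {X : RealTrace G // X.IsFinite} :=
  ⟨{ block := fun m => if m < n then X.block m else if m = n then S else ∅
     isClique := by
      intro m
      split_ifs with h1 h2
      · exact X.isClique m
      · subst h2
        exact (X.isClique m).subset (by exact_mod_cast hS)
      · simp
     foata := by
      intro m a ha
      split_ifs at ha with h1 h2
      · rw [if_pos (by omega)]
        exact X.foata m a ha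
      · rw [if_pos (by omega)]
        subst h2
        exact X.foata m a (hS ha)
      · simp at ha },
    ⟨n + 1, fun m hm => by
      have h1 : ¬ m < n := by omega
      have h2 : m ≠ n := by omega
      simp [h1, h2]⟩⟩

theorem act_cliqueProd {A : Type*} {G : SimpleGraph A} (X : RealTrace G) (n : ℕ) (S : Finset A)
    (hS : S ⊆ X.block n) (hc : G.IsClique (S : Set A)) :
    (act G (TraceMonoid.cliqueProd G S hc)).unop (X.cut n ∅ (Finset.empty_subset _)) =
      X.cut n S hS := by
  classical
  induction S using Finset.induction_on with
  | empty => simp [TraceMonoid.cliqueProd]; rfl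
  | insert a S ha ih =>
    have hS' : S ⊆ X.block n := (Finset.subset_insert a S).trans hS
    have hc' : G.IsClique (S : Set A) := hc.subset (by simp)
    have haX : a ∈ X.block n := hS (Finset.mem_insert_self a S)
    have hprod : TraceMonoid.cliqueProd G (insert a S) hc =
        TraceMonoid.cliqueProd G S hc' * TraceMonoid.of G a :=
      Finset.noncommProd_insert_of_notMem' _ _ _ _ ha
    rw [hprod, act_mul, ih hS' hc', act_of]
    have hblock : ∀ m, (X.cut n S hS').1.block m =
        if m < n then X.block m else if m = n then S else ∅ := fun _ => rfl
    have hheight : (X.cut n S hS').1.height a = n := by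
      apply le_antisymm
      · apply height_le
        intro m hm b hb
        rw [hblock, if_neg (by omega)] at hb
        split_ifs at hb with h
        · exact X.isClique n haX (hS' hb) (fun hab => ha (hab ▸ hb))
        · simp at hb
      · by_contra hlt
        push Not at hlt
        obtain ⟨k, rfl⟩ : ∃ k, n = k + 1 := ⟨n - 1, by omega⟩
        obtain ⟨b, hb, hab⟩ := X.foata k a haX
        refine hab (height_spec (X.cut (k + 1) S hS').2 a k (by omega) b ?_)
        rw [hblock, if_pos (by omega)]
        exact hb
    apply Subtype.ext
    apply RealTrace.ext
    funext m
    change (if m = (X.cut n S hS').1.height a then insert a ((X.cut n S hS').1.block m)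
      else (X.cut n S hS').1.block m) =
        if m < n then X.block m else if m = n then insert a S else ∅
    rw [hheight, hblock]
    split_ifs <;> first | rfl | omega

theorem act_pre {A : Type*} {G : SimpleGraph A} (X : RealTrace G) (n : ℕ) :
    (act G (X.pre n)).unop (nil G) = X.cut n ∅ (Finset.empty_subset _) := by
  induction n with
  | zero =>
    apply Subtype.ext
    apply RealTrace.ext
    funext m
    change (nil G).1.block m = _
    simp [cut, nil]
  | succ n ih =>
    simp only [pre]
    rw [act_mul, ih, act_cliqueProd X n (X.block n) subset_rfl]
    apply Subtype.ext
    apply RealTrace.ext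
    funext m
    simp only [cut]
    split_ifs <;> first | rfl | omega | simp_all

theorem cut_eq {A : Type*} {G : SimpleGraph A} {X : RealTrace G} {N : ℕ}
    (hN : ∀ n ≥ N, X.block n = ∅) : (X.cut N ∅ (Finset.empty_subset _)).1 = X := by
  apply RealTrace.ext
  funext m
  simp only [cut]
  split_ifs with h1 h2
  · rfl
  · exact (hN m (by omega)).symm
  · exact (hN m (by omega)).symm

/-- Every element of the trace monoid has exactly one Foata normal form. -/
theorem existsUnique_isFoataOf {A : Type*} {G : SimpleGraph A} (u : TraceMonoid G) :
    ∃! X : RealTrace G, X.IsFoataOf u := by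
  refine ⟨_, isFoataOf_act u, ?_⟩
  rintro X ⟨N, hN, rfl⟩
  rw [act_pre, cut_eq hN]

end RealTrace

/-- The set of real traces is complete. -/
instance {A : Type*} (G : SimpleGraph A) : CompleteSpace (RealTrace G) := by
  refine Metric.complete_of_cauchySeq_tendsto fun u hu => ?_
  have hlt : ∀ {X Y : RealTrace G} {n : ℕ}, dist X Y < (1 / 2) ^ n →
      ∀ i ≤ n, X.block i = Y.block i := by
    intro X Y n h i hi
    rw [RealTrace.dist_def] at h
    exact PiNat.apply_eq_of_dist_lt h hi
  have hN : ∀ n : ℕ, ∃ N, ∀ m ≥ N, ∀ k ≥ N, ∀ i ≤ n, (u m).block i = (u k).block i := by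
    intro n
    obtain ⟨N, hN⟩ := Metric.cauchySeq_iff.1 hu ((1 / 2) ^ n) (by positivity)
    exact ⟨N, fun m hm k hk => hlt (hN m hm k hk)⟩
  choose N hN using hN
  have hX : ∀ n k, k ≥ N n → ∀ i ≤ n, (u (N i)).block i = (u k).block i := by
    intro n k hk i hi
    rw [hN i (N i) le_rfl (max (N i) (N n)) (le_max_left _ _) i le_rfl]
    exact hN n _ (le_max_right _ _) k hk i hi
  let X : RealTrace G :=
    { block := fun n => (u (N n)).block n
      isClique := fun n => (u (N n)).isClique n
      foata := fun n a ha => by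
        rw [hX (n + 1) (N (n + 1)) le_rfl n (by omega)]
        exact (u (N (n + 1))).foata n a ha }
  refine ⟨X, Metric.tendsto_atTop.2 fun ε hε => ?_⟩
  obtain ⟨n, hn⟩ := exists_pow_lt_of_lt_one hε (by norm_num : (1 / 2 : ℝ) < 1)
  refine ⟨N n, fun k hk => lt_of_le_of_lt ?_ hn⟩
  rw [RealTrace.dist_def]
  refine PiNat.mem_cylinder_iff_dist_le.1 (PiNat.mem_cylinder_iff.2 fun i hi => ?_)
  exact (hX n k hk i hi.le).symm

namespace TraceMonoid

/-- The embedding of `M(A, I)` in the set of real traces: `u` is sent to its Foata normal form. -/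
noncomputable def toReal {A : Type*} {G : SimpleGraph A} (u : TraceMonoid G) : RealTrace G :=
  (RealTrace.existsUnique_isFoataOf u).choose

theorem isFoataOf_toReal {A : Type*} {G : SimpleGraph A} (u : TraceMonoid G) :
    u.toReal.IsFoataOf u := (RealTrace.existsUnique_isFoataOf u).choose_spec.1

theorem toReal_eq {A : Type*} {G : SimpleGraph A} {u : TraceMonoid G} {X : RealTrace G}
    (h : X.IsFoataOf u) : u.toReal = X :=
  ((RealTrace.existsUnique_isFoataOf u).choose_spec.2 X h).symm

theorem toReal_injective {A : Type*} {G : SimpleGraph A} :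
    Function.Injective (toReal (G := G)) := by
  intro u v huv
  obtain ⟨N, hN, hu⟩ := isFoataOf_toReal u
  obtain ⟨K, hK, hv⟩ := isFoataOf_toReal v
  have key : ∀ (X : RealTrace G) (n k : ℕ), (∀ m ≥ n, X.block m = ∅) →
      X.pre (n + k) = X.pre n := by
    intro X n k h
    induction k with
    | zero => rfl
    | succ k ih =>
      rw [← Nat.add_assoc]
      simp only [RealTrace.pre]
      rw [ih]
      have : ∀ (B : Finset A) (hB : G.IsClique (B : Set A)), B = ∅ → cliqueProd G B hB = 1 := by
        rintro _ _ rfl; simp [cliqueProd]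
      rw [this _ _ (h _ (by omega)), mul_one]
  rw [← hu, ← hv, ← key _ N K hN, ← key _ K N hK, huv, Nat.add_comm]

/-- The FNF metric on `M(A, I)`. -/
noncomputable instance {A : Type*} (G : SimpleGraph A) : MetricSpace (TraceMonoid G) :=
  MetricSpace.induced toReal toReal_injective inferInstance

theorem isometry_toReal {A : Type*} (G : SimpleGraph A) : Isometry (toReal (G := G)) :=
  fun _ _ => rfl

theorem denseRange_toReal {A : Type*} (G : SimpleGraph A) : DenseRange (toReal (G := G)) := by
  intro X
  rw [Metric.mem_closure_range_iff]
  intro ε hε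
  obtain ⟨n, hn⟩ := exists_pow_lt_of_lt_one hε (by norm_num : (1 / 2 : ℝ) < 1)
  refine ⟨X.pre n, lt_of_le_of_lt ?_ hn⟩
  have h : (X.pre n).toReal = (X.cut n ∅ (Finset.empty_subset _)).1 := by
    apply toReal_eq
    rw [← RealTrace.act_pre]
    exact RealTrace.isFoataOf_act _
  rw [h, RealTrace.dist_def]
  refine PiNat.mem_cylinder_iff_dist_le.1 ?_
  rw [PiNat.mem_cylinder_iff]
  intro i hi
  simp [RealTrace.cut, hi]

theorem isDenseInducing_toReal {A : Type*} (G : SimpleGraph A) :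
    IsDenseInducing (toReal (G := G)) :=
  ⟨(isometry_toReal G).isUniformInducing.isInducing, denseRange_toReal G⟩

/-- The continuous extension `Φ` of a (uniformly continuous) endomorphism `φ` of `M(A, I)` to the
real traces: `Φ(X)` is the limit of `φ(u)` as `u ∈ M(A, I)` tends to `X`. -/
noncomputable def extension {A : Type*} {G : SimpleGraph A} (φ : Monoid.End (TraceMonoid G)) :
    RealTrace G → RealTrace G :=
  (isDenseInducing_toReal G).extend fun u => (φ u).toReal

theorem continuous_extension {A : Type*} {G : SimpleGraph A}
    {φ : Monoid.End (TraceMonoid G)} (hφ : UniformContinuous φ) :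
    Continuous (TraceMonoid.extension φ) :=
  (uniformContinuous_uniformly_extend (TraceMonoid.isometry_toReal G).isUniformInducing
    (TraceMonoid.denseRange_toReal G)
    ((TraceMonoid.isometry_toReal G).uniformContinuous.comp hφ)).continuous

theorem extension_toReal {A : Type*} {G : SimpleGraph A}
    {φ : Monoid.End (TraceMonoid G)} (hφ : UniformContinuous φ) (u : TraceMonoid G) :
    TraceMonoid.extension φ u.toReal = (φ u).toReal :=
  (TraceMonoid.isDenseInducing_toReal G).extend_eq
    ((TraceMonoid.isometry_toReal G).continuous.comp hφ.continuous) u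

/-- The mixed product `uX`: the limit of `uv` as `v ∈ M(A, I)` tends to `X`. -/
noncomputable def mixedMul {A : Type*} {G : SimpleGraph A} (u : TraceMonoid G) :
    RealTrace G → RealTrace G :=
  (isDenseInducing_toReal G).extend fun v => (u * v).toReal

end TraceMonoid

open scoped Pointwise in
/-- The mp-rational sets of real traces: those obtained from finite sets by finitely many
applications of union, product and star (of subsets of `M(A, I)`) and mixed product (of a subset of
`M(A, I)` with a subset of the boundary). -/
inductive IsMPRational {A : Type*} {G : SimpleGraph A} : Set (RealTrace G) → Prop
  | finite {Y : Set (RealTrace G)} (h : Y.Finite) : IsMPRational Y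
  | union {Y Z : Set (RealTrace G)} (hY : IsMPRational Y) (hZ : IsMPRational Z) :
      IsMPRational (Y ∪ Z)
  | product {K L : Set (TraceMonoid G)} (hK : IsMPRational (TraceMonoid.toReal '' K))
      (hL : IsMPRational (TraceMonoid.toReal '' L)) :
      IsMPRational (TraceMonoid.toReal '' (K * L))
  | star {K : Set (TraceMonoid G)} (hK : IsMPRational (TraceMonoid.toReal '' K)) :
      IsMPRational (TraceMonoid.toReal '' (Submonoid.closure K : Set (TraceMonoid G)))
  | mixed {K : Set (TraceMonoid G)} {Y : Set (RealTrace G)} (hYb : Y ⊆ RealTrace.boundary G)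
      (hK : IsMPRational (TraceMonoid.toReal '' K)) (hY : IsMPRational Y) :
      IsMPRational (Set.image2 TraceMonoid.mixedMul K Y)

/-- The five-vertex graph with a vertex `1` adjacent to all the others, in which `0 - 3 - 4` is a
path and `2` has no other neighbour. -/
def coneGraph : SimpleGraph (Fin 5) :=
  SimpleGraph.fromEdgeSet {s(0, 1), s(1, 2), s(0, 3), s(1, 3), s(1, 4), s(3, 4)}

/-- A graph is of type T if no full (that is, induced) subgraph of it is a path on four vertices, a
cycle on four vertices or the graph `coneGraph`. -/
def SimpleGraph.IsTypeT {A : Type*} (G : SimpleGraph A) : Prop :=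
  ¬ SimpleGraph.pathGraph 4 ⊴ G ∧ ¬ SimpleGraph.cycleGraph 4 ⊴ G ∧ ¬ coneGraph ⊴ G

/-- The disjoint union of complete graphs with vertex sets `V i`. -/
def disjointUnionComplete {ι : Type*} (V : ι → Type*) : SimpleGraph (Σ i, V i) where
  Adj x y := x ≠ y ∧ x.1 = y.1
  symm := ⟨fun _ _ h => ⟨h.1.symm, h.2.symm⟩⟩
  loopless := ⟨fun _ h => h.1 rfl⟩

open scoped SimpleGraph

/-! ### The trace monoid: normal forms, cancellation, left divisibility -/

namespace TraceMonoid

variable {A : Type*} {G : SimpleGraph A}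

/-! Condition (ii) is the hinge. It says that adjacency-or-equality is an equivalence relation,
whose classes are complete components; this gives (iii), and matching generators gives (iv).
Conversely, an isomorphism as in (iv) sends letters, which are the elements of length one, to basis
elements of the factors, and two of these commute exactly when they lie in the same factor; so (ii)
follows (`transitive_of_equivCoprodI`).

(i) implies (ii) by counting. If `b` is adjacent to distinct nonadjacent `a` and `c`, let φ double
`b` and fix all other letters. An infinite trace whose blocks are `{a, b}` or `{b, c}` in any order
contains infinitely many `b`, all commuting with everything else, so doubling them changes nothing
in the limit. This gives continuum many fixed points of Φ. None is a limit of fixed points of φ,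
since those contain no `b`; but an mp-rational set is countable (`fixedPoints_squareLetter_ne`).

For (ii) implies (i), uniform continuity is first translated into the combinatorial condition
`PreservesDependence`. Real traces are then handled as suprema of chains for left divisibility, with
which Φ and the mixed product are compatible (`isSup_extension`, `isSup_mixedMul`). Two sources of
infinite fixed points have to be controlled.

The first consists of those whose letters commute from some block on. They are ultimately constant,
of the form `u f w_S w_S ⋯` with finitely many `u` and `S` and with `f` in a free commutative
monoid. The exponents of the admissible `f` have the slice property, hence form a semilinear set,
whose image is mp-rational (`exists_isMPRational_commutesFrom`). This settles complete graphs.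

If the graph is not complete, φ erases all letters or none. When it erases none, the finite fixed
points are generated by fixed cliques, and an infinite fixed point outside the closure is `uX` with
`u` a finite fixed point and `X` a fixed point whose first clique `B` is not fixed. The iterates
`φⁿ(w_B)` are prefixes of `X` of unbounded length. Either they show letters of different components
arbitrarily deep and so determine `X`, or from some block on `X` stays in one component and belongs
to the first source (`exists_isMPRational_block_zero`). -/

theorem induction_right {P : TraceMonoid G → Prop} (one : P 1)
    (mul_of : ∀ u a, P u → P (u * of G a)) (u : TraceMonoid G) : P u := by
  have hu : u ∈ Submonoid.closure (Set.range (of G)) := by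
    have := PresentedMonoid.closure_range_of (TraceRel G)
    exact (Submonoid.eq_top_iff' _).1 this u
  induction hu using Submonoid.closure_induction_right with
  | one => exact one
  | mul_right x _ y hy ih =>
    obtain ⟨a, rfl⟩ := hy
    exact mul_of _ a ih

/-- The homomorphism given by a map on the letters that respects the independence relation. -/
noncomputable def lift {M : Type*} [Monoid M] (f : A → M)
    (h : ∀ a b, G.Adj a b → Commute (f a) (f b)) : TraceMonoid G →* M :=
  PresentedMonoid.lift (rels := TraceRel G) f (by
    rintro _ _ ⟨hab⟩
    simpa using (h _ _ hab).eq)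

@[simp]
theorem lift_of {M : Type*} [Monoid M] (f : A → M)
    (h : ∀ a b, G.Adj a b → Commute (f a) (f b)) (a : A) : lift f h (of G a) = f a := by
  change FreeMonoid.lift f (FreeMonoid.of a) = f a
  simp

theorem hom_ext {M : Type*} [Monoid M] {f g : TraceMonoid G →* M}
    (h : ∀ a, f (of G a) = g (of G a)) : f = g := by
  ext u
  induction u using induction_right with
  | one => simp
  | mul_of u a ih => rw [map_mul, map_mul, ih, h]

/-! #### Length -/

/-- The length of a trace. -/
noncomputable def length (u : TraceMonoid G) : ℕ :=
  (lift (G := G) (fun _ => Multiplicative.ofAdd 1) (fun _ _ _ => Commute.all _ _) u).toAdd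

@[simp] theorem length_one : length (1 : TraceMonoid G) = 0 := by simp [length]

@[simp] theorem length_of (a : A) : length (of G a) = 1 := by simp [length]

@[simp] theorem length_mul (u v : TraceMonoid G) : length (u * v) = length u + length v := by
  simp [length]

theorem length_eq_zero {u : TraceMonoid G} : length u = 0 ↔ u = 1 := by
  constructor
  · induction u using induction_right with
    | one => simp
    | mul_of u a _ => intro h; simp at h
  · rintro rfl; simp

/-! #### Blocks of the normal form -/

/-- The `n`-th block of the Foata normal form of a trace. -/
noncomputable def blk (u : TraceMonoid G) (n : ℕ) : Finset A := u.toReal.block n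

/-- The index of the block in which a new last letter `a` is to be placed. -/
noncomputable def ht (u : TraceMonoid G) (a : A) : ℕ := u.toReal.height a

theorem isFinite_toReal (u : TraceMonoid G) : u.toReal.IsFinite :=
  let ⟨N, h, _⟩ := isFoataOf_toReal u
  ⟨N, h⟩

theorem toReal_mul_of (u : TraceMonoid G) (a : A) :
    (u * of G a).toReal = (RealTrace.ins a ⟨u.toReal, isFinite_toReal u⟩).1 :=
  toReal_eq (RealTrace.isFoataOf_ins (X := ⟨u.toReal, isFinite_toReal u⟩) (isFoataOf_toReal u))

theorem blk_mul_of [DecidableEq A] (u : TraceMonoid G) (a : A) (n : ℕ) :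
    blk (u * of G a) n = if n = ht u a then insert a (blk u n) else blk u n := by
  unfold blk ht
  rw [toReal_mul_of]
  simp only [RealTrace.ins]
  split_ifs
  · ext; simp
  · rfl

theorem mem_blk_mul_of {u : TraceMonoid G} {a c : A} {n : ℕ} :
    c ∈ blk (u * of G a) n ↔ c ∈ blk u n ∨ (c = a ∧ n = ht u a) := by
  classical
  rw [blk_mul_of]
  split_ifs with h
  · simp [h, or_comm]
  · simp [h]

theorem ext_blk {u v : TraceMonoid G} (h : ∀ n, blk u n = blk v n) : u = v :=
  toReal_injective (RealTrace.ext (funext h))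

@[simp]
theorem blk_one (n : ℕ) : blk (1 : TraceMonoid G) n = ∅ := by
  have : (1 : TraceMonoid G).toReal = (RealTrace.nil G).1 := toReal_eq ⟨0, fun _ _ => rfl, rfl⟩
  unfold blk
  rw [this]
  rfl

theorem adj_of_ht_le {u : TraceMonoid G} {a b : A} {n : ℕ} (h : ht u a ≤ n) (hb : b ∈ blk u n) :
    G.Adj a b := RealTrace.height_spec (isFinite_toReal u) a n h b hb

theorem lt_ht {u : TraceMonoid G} {a b : A} {n : ℕ} (hb : b ∈ blk u n) (h : ¬ G.Adj a b) :
    n < ht u a := by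
  by_contra hlt
  exact h (adj_of_ht_le (not_lt.1 hlt) hb)

theorem exists_of_ht {u : TraceMonoid G} {a : A} {n : ℕ} (h : ht u a = n + 1) :
    ∃ b ∈ blk u n, ¬ G.Adj a b := RealTrace.exists_of_height (isFinite_toReal u) h

theorem ht_le {u : TraceMonoid G} {a : A} {n : ℕ} (h : ∀ m ≥ n, ∀ b ∈ blk u m, G.Adj a b) :
    ht u a ≤ n := RealTrace.height_le h

theorem isClique_blk (u : TraceMonoid G) (n : ℕ) : G.IsClique (blk u n : Set A) :=
  u.toReal.isClique n

theorem ht_le_ht_mul_of (u : TraceMonoid G) (a b : A) : ht u a ≤ ht (u * of G b) a := by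
  rcases h : ht u a with _ | n
  · exact Nat.zero_le _
  · obtain ⟨c, hc, hac⟩ := exists_of_ht h
    exact lt_ht (mem_blk_mul_of.2 (Or.inl hc)) hac

theorem blk_subset_mul (u v : TraceMonoid G) (n : ℕ) : blk u n ⊆ blk (u * v) n := by
  induction v using induction_right with
  | one => simp
  | mul_of v a ih =>
    rw [← mul_assoc]
    exact fun c hc => mem_blk_mul_of.2 (Or.inl (ih hc))

theorem blk_subset_of_dvd {u v : TraceMonoid G} (h : u ∣ v) (n : ℕ) : blk u n ⊆ blk v n := by
  obtain ⟨w, rfl⟩ := h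
  exact blk_subset_mul u w n

theorem ht_le_ht_mul (u v : TraceMonoid G) (a : A) : ht u a ≤ ht (u * v) a := by
  induction v using induction_right with
  | one => simp
  | mul_of v b ih =>
    rw [← mul_assoc]
    exact ih.trans (ht_le_ht_mul_of _ _ _)

/-! #### The letters of a trace -/

/-- The set of letters that occur in a trace. -/
def alph (u : TraceMonoid G) : Set A := {a | ∃ n, a ∈ blk u n}

theorem mem_alph_of_mem_blk {u : TraceMonoid G} {a : A} {n : ℕ} (h : a ∈ blk u n) : a ∈ alph u :=
  ⟨n, h⟩

@[simp]
theorem alph_one : alph (1 : TraceMonoid G) = ∅ := by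
  ext; simp [alph]

theorem alph_mul_of (u : TraceMonoid G) (a : A) : alph (u * of G a) = alph u ∪ {a} := by
  ext c
  simp [alph, mem_blk_mul_of, exists_or, or_comm]

@[simp]
theorem alph_of (a : A) : alph (of G a) = {a} := by
  rw [← one_mul (of G a), alph_mul_of]
  simp

@[simp]
theorem alph_mul (u v : TraceMonoid G) : alph (u * v) = alph u ∪ alph v := by
  induction v using induction_right with
  | one => simp
  | mul_of v a ih => rw [← mul_assoc, alph_mul_of, ih, alph_mul_of, Set.union_assoc]

theorem alph_subset_of_dvd {u v : TraceMonoid G} (h : u ∣ v) : alph u ⊆ alph v := by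
  obtain ⟨w, rfl⟩ := h
  simp

theorem alph_eq_empty {u : TraceMonoid G} : alph u = ∅ ↔ u = 1 := by
  constructor
  · induction u using induction_right with
    | one => simp
    | mul_of u a _ =>
      intro h
      rw [alph_mul_of, Set.union_singleton] at h
      exact absurd h (Set.insert_nonempty _ _).ne_empty
  · rintro rfl; simp

theorem commute_of_alph {u v : TraceMonoid G}
    (h : ∀ a ∈ alph u, ∀ b ∈ alph v, G.Adj a b ∨ a = b) : Commute u v := by
  induction u using induction_right with
  | one => exact Commute.one_left _
  | mul_of u a ih =>
    refine (ih fun c hc => h c (by simp [hc])).mul_left ?_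
    replace h := h a (by simp)
    clear ih
    induction v using induction_right with
    | one => exact Commute.one_right _
    | mul_of v b ih =>
      refine (ih fun c hc => h c (by simp [hc])).mul_right ?_
      rcases h b (by simp) with h | rfl
      · exact of_commute h
      · exact Commute.refl _

/-! #### Cancellation -/

/-- The appended `a` lies strictly above every other occurrence of `a`, because `a` is not adjacent
to itself. So its block can be read off from the product, and deleting it there recovers the other
blocks. -/
theorem mul_of_cancel {u v : TraceMonoid G} {a : A} (h : u * of G a = v * of G a) : u = v := by
  have key : ∀ {u v : TraceMonoid G}, u * of G a = v * of G a → ht u a ≤ ht v a := by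
    intro u v h
    have h1 : a ∈ blk (v * of G a) (ht u a) := by
      rw [← h, mem_blk_mul_of]; simp
    rcases mem_blk_mul_of.1 h1 with h2 | h2
    · exact (lt_ht h2 (G.loopless.irrefl a)).le
    · exact h2.2.le
  have hht : ht u a = ht v a := le_antisymm (key h) (key h.symm)
  have key' : ∀ {u v : TraceMonoid G}, u * of G a = v * of G a → ht u a = ht v a →
      ∀ n, blk u n ⊆ blk v n := by
    intro u v h hht n c hc
    have h1 : c ∈ blk (v * of G a) n := by
      rw [← h, mem_blk_mul_of]; exact Or.inl hc
    rcases mem_blk_mul_of.1 h1 with h2 | ⟨rfl, rfl⟩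
    · exact h2
    · exact absurd (lt_ht hc (G.loopless.irrefl c)) (by omega)
  exact ext_blk fun n => (key' h hht n).antisymm (key' h.symm hht.symm n)

/-- The reversal of a trace. -/
noncomputable def reverse : TraceMonoid G →* (TraceMonoid G)ᵐᵒᵖ :=
  lift (fun a => MulOpposite.op (of G a)) fun _ _ h =>
    congrArg MulOpposite.op (of_commute h.symm)

@[simp]
theorem reverse_of (a : A) : reverse (of G a) = MulOpposite.op (of G a) := lift_of _ _ a

theorem unop_reverse_reverse (u : TraceMonoid G) :
    (reverse (reverse u).unop).unop = u := by
  induction u using induction_right with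
  | one => simp
  | mul_of u a ih => rw [map_mul, MulOpposite.unop_mul, map_mul, MulOpposite.unop_mul, ih]; simp

instance : IsRightCancelMul (TraceMonoid G) where
  mul_right_cancel w u v h := by
    change u * w = v * w at h
    induction w using induction_right with
    | one => simpa using h
    | mul_of w a ih =>
      rw [← mul_assoc, ← mul_assoc] at h
      exact ih (mul_of_cancel h)

/-- Reversal is an involution that turns right cancellation into left cancellation. -/
instance : IsLeftCancelMul (TraceMonoid G) where
  mul_left_cancel w u v h := by
    have h1 := congrArg (fun x => (reverse x).unop) h
    simp only [map_mul, MulOpposite.unop_mul] at h1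
    have h2 := mul_right_cancel h1
    rw [← unop_reverse_reverse u, h2, unop_reverse_reverse]

/-! #### Initial segments of the normal form -/

theorem cliqueProd_congr {B C : Finset A} {hB : G.IsClique (B : Set A)}
    {hC : G.IsClique (C : Set A)} (h : B = C) : cliqueProd G B hB = cliqueProd G C hC := by
  subst h; rfl

@[simp]
theorem cliqueProd_empty (h : G.IsClique ((∅ : Finset A) : Set A)) : cliqueProd G ∅ h = 1 := by
  simp [cliqueProd]

theorem cliqueProd_insert [DecidableEq A] {B : Finset A} {a : A} (ha : a ∉ B)
    (h : G.IsClique ((insert a B : Finset A) : Set A)) :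
    cliqueProd G (insert a B) h = cliqueProd G B (h.subset (by simp)) * of G a :=
  Finset.noncommProd_insert_of_notMem' _ _ _ _ ha

@[simp]
theorem length_cliqueProd {B : Finset A} (h : G.IsClique (B : Set A)) :
    length (cliqueProd G B h) = B.card := by
  classical
  induction B using Finset.induction_on with
  | empty => simp
  | insert a B ha ih =>
    rw [cliqueProd_insert ha, length_mul, ih, Finset.card_insert_of_notMem ha]
    simp

@[simp]
theorem alph_cliqueProd {B : Finset A} (h : G.IsClique (B : Set A)) :
    alph (cliqueProd G B h) = B := by
  classical
  induction B using Finset.induction_on with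
  | empty => simp
  | insert a B ha ih => rw [cliqueProd_insert ha, alph_mul, ih]; simp

theorem of_dvd_cliqueProd {B : Finset A} (h : G.IsClique (B : Set A)) {a : A} (ha : a ∈ B) :
    of G a ∣ cliqueProd G B h := by
  classical
  have hB : insert a (B.erase a) = B := Finset.insert_erase ha
  rw [← cliqueProd_congr (hB := by rwa [hB]) hB, cliqueProd_insert (Finset.notMem_erase a B)]
  refine ⟨cliqueProd G (B.erase a) (h.subset (by simp)), ?_⟩
  apply (commute_of_alph _).eq
  intro b hb c hc
  rw [alph_cliqueProd] at hb
  simp only [alph_of, Set.mem_singleton_iff] at hc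
  subst hc
  exact Or.inl (h (Finset.mem_of_mem_erase hb) ha (Finset.ne_of_mem_erase hb))

end TraceMonoid

namespace RealTrace

variable {A : Type*} {G : SimpleGraph A}

open TraceMonoid

@[simp] theorem pre_zero (X : RealTrace G) : X.pre 0 = 1 := rfl

theorem pre_succ (X : RealTrace G) (n : ℕ) :
    X.pre (n + 1) = X.pre n * cliqueProd G (X.block n) (X.isClique n) := rfl

theorem pre_congr {X Y : RealTrace G} {n : ℕ} (h : ∀ i < n, X.block i = Y.block i) :
    X.pre n = Y.pre n := by
  induction n with
  | zero => rfl
  | succ n ih =>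
    rw [pre_succ, pre_succ, ih fun i hi => h i (by omega), cliqueProd_congr (h n (by omega))]

theorem pre_dvd_pre (X : RealTrace G) {m n : ℕ} (h : m ≤ n) : X.pre m ∣ X.pre n := by
  induction n, h using Nat.le_induction with
  | base => exact dvd_rfl
  | succ n _ ih => exact ih.trans ⟨_, rfl⟩

theorem toReal_pre (X : RealTrace G) (n : ℕ) :
    (X.pre n).toReal = (X.cut n ∅ (Finset.empty_subset _)).1 := by
  apply toReal_eq
  rw [← RealTrace.act_pre]
  exact RealTrace.isFoataOf_act _

theorem blk_pre (X : RealTrace G) (n i : ℕ) :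
    blk (X.pre n) i = if i < n then X.block i else ∅ := by
  unfold blk
  rw [toReal_pre]
  simp [cut]

theorem blk_pre_of_lt (X : RealTrace G) {n i : ℕ} (h : i < n) : blk (X.pre n) i = X.block i := by
  rw [blk_pre, if_pos h]

end RealTrace

namespace TraceMonoid

variable {A : Type*} {G : SimpleGraph A}

theorem pre_mul_of_of_le {u : TraceMonoid G} {a : A} {k : ℕ} (h : k ≤ ht u a) :
    (u * of G a).toReal.pre k = u.toReal.pre k := by
  classical
  refine RealTrace.pre_congr fun i hi => ?_
  have := blk_mul_of u a i
  rwa [if_neg (by omega)] at this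

/-- The new letter is adjacent to all letters in the blocks from `ht u a` on, so it can be moved
past the later ones to the end of the prefix. -/
theorem pre_mul_of_of_lt {u : TraceMonoid G} {a : A} {k : ℕ} (h : ht u a < k) :
    (u * of G a).toReal.pre k = u.toReal.pre k * of G a := by
  classical
  induction k, h using Nat.le_induction with
  | base =>
    have hb : (u * of G a).toReal.block (ht u a) = _ := blk_mul_of u a (ht u a)
    rw [if_pos rfl] at hb
    have hnot : a ∉ blk u (ht u a) := fun hmem =>
      absurd (lt_ht hmem (G.loopless.irrefl a)) (by omega)
    rw [RealTrace.pre_succ, pre_mul_of_of_le le_rfl, cliqueProd_congr (hC := by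
      rw [← hb]; exact RealTrace.isClique _ _) hb, cliqueProd_insert hnot, RealTrace.pre_succ,
      mul_assoc]
    rfl
  | succ k hk ih =>
    have hb : (u * of G a).toReal.block k = _ := blk_mul_of u a k
    rw [if_neg (by omega)] at hb
    rw [RealTrace.pre_succ, ih, cliqueProd_congr (hC := isClique_blk _ _) hb,
      RealTrace.pre_succ, mul_assoc, mul_assoc]
    congr 1
    apply (commute_of_alph _).eq
    intro b hb' c hc
    rw [alph_cliqueProd] at hc
    simp only [alph_of, Set.mem_singleton_iff] at hb'
    subst hb'
    exact Or.inl (adj_of_ht_le (by omega) hc)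

/-- Truncation is monotone for left divisibility; this is what allows limits in the metric to be
treated as suprema. -/
theorem pre_dvd_pre_mul (u v : TraceMonoid G) (k : ℕ) : u.toReal.pre k ∣ (u * v).toReal.pre k := by
  induction v using induction_right with
  | one => simp
  | mul_of v a ih =>
    rw [← mul_assoc]
    rcases le_or_gt k (ht (u * v) a) with h | h
    · rwa [pre_mul_of_of_le h]
    · rw [pre_mul_of_of_lt h]
      exact ih.trans ⟨_, rfl⟩

theorem pre_dvd_pre_of_dvd {u v : TraceMonoid G} (h : u ∣ v) (k : ℕ) :
    u.toReal.pre k ∣ v.toReal.pre k := by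
  obtain ⟨w, rfl⟩ := h
  exact pre_dvd_pre_mul u w k

theorem exists_pre_eq (u : TraceMonoid G) : ∃ N, ∀ k ≥ N, u.toReal.pre k = u := by
  obtain ⟨N, hN, hu⟩ := isFoataOf_toReal u
  refine ⟨N, fun k hk => ?_⟩
  induction k, hk using Nat.le_induction with
  | base => exact hu
  | succ k hk ih =>
    rw [RealTrace.pre_succ, ih, cliqueProd_congr (hC := by simp) (hN k hk), cliqueProd_empty,
      mul_one]

theorem pre_dvd (u : TraceMonoid G) (k : ℕ) : u.toReal.pre k ∣ u := by
  obtain ⟨N, hN⟩ := exists_pre_eq u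
  have := u.toReal.pre_dvd_pre (le_max_left k N)
  rwa [hN _ (le_max_right k N)] at this

/-- Together with `mem_blk_zero_of_dvd` this describes the first block without reference to the
normal form. -/
theorem of_dvd_of_mem_blk_zero {u : TraceMonoid G} {a : A} (h : a ∈ blk u 0) : of G a ∣ u := by
  refine dvd_trans ?_ (pre_dvd u 1)
  rw [RealTrace.pre_succ, RealTrace.pre_zero, one_mul]
  exact of_dvd_cliqueProd _ h

theorem mem_blk_zero_of_dvd {u : TraceMonoid G} {a : A} (h : of G a ∣ u) : a ∈ blk u 0 := by
  refine blk_subset_of_dvd h 0 ?_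
  rw [← one_mul (of G a), mem_blk_mul_of]
  refine Or.inr ⟨rfl, (Nat.le_zero.1 (ht_le ?_)).symm⟩
  simp

end TraceMonoid

/-! ### Uniform continuity of endomorphisms -/

namespace RealTrace

variable {A : Type*} {G : SimpleGraph A}

theorem dist_lt_iff {X Y : RealTrace G} {n : ℕ} :
    dist X Y < (1 / 2) ^ n ↔ ∀ i ≤ n, X.block i = Y.block i := by
  constructor
  · intro h i hi
    rw [dist_def] at h
    exact PiNat.apply_eq_of_dist_lt h hi
  · intro h
    have h1 : dist X Y ≤ (1 / 2) ^ (n + 1) := by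
      rw [dist_def]
      exact PiNat.mem_cylinder_iff_dist_le.1 (PiNat.mem_cylinder_iff.2 fun i hi => h i (by omega))
    exact h1.trans_lt (pow_lt_pow_right_of_lt_one₀ (by norm_num) (by norm_num) (by omega))

end RealTrace

namespace TraceMonoid

variable {A : Type*} {G : SimpleGraph A}

theorem dist_lt_iff {u v : TraceMonoid G} {n : ℕ} :
    dist u v < (1 / 2) ^ n ↔ ∀ i ≤ n, blk u i = blk v i := RealTrace.dist_lt_iff

/-- The combinatorial form of uniform continuity: if `a` and `b` are dependent, then every first
letter of `φ b` depends on some letter of `φ a`. -/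
def PreservesDependence (φ : Monoid.End (TraceMonoid G)) : Prop :=
  ∀ a b, ¬ G.Adj a b → ∀ c ∈ blk (φ (of G b)) 0, ∃ c' ∈ alph (φ (of G a)), ¬ G.Adj c' c

/-- If all the first letters of `w` are inserted in `u` at height at least `k`, then so are all
the letters of `w`. -/
theorem blk_mul_of_le_ht {u w : TraceMonoid G} {k : ℕ} (h : ∀ c ∈ blk w 0, k ≤ ht u c) :
    (∀ i < k, blk (u * w) i = blk u i) ∧ ∀ c ∈ alph w, ∃ n ≥ k, c ∈ blk (u * w) n := by
  classical
  induction w using induction_right with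
  | one => simp
  | mul_of w a ih =>
    obtain ⟨ih1, ih2⟩ := ih fun c hc => h c (blk_subset_mul w _ 0 hc)
    have ha : k ≤ ht (u * w) a := by
      -- A letter placed in block 0 of `w` is a first letter of the product. Any other one depends
      -- on a letter of `w` that already sits at height at least `k`, and must lie above it.
      rcases hw : ht w a with _ | n
      · exact (h a (mem_blk_mul_of.2 (Or.inr ⟨rfl, hw.symm⟩))).trans (ht_le_ht_mul u w a)
      · obtain ⟨b, hb, hab⟩ := exists_of_ht hw
        obtain ⟨m, hm, hbm⟩ := ih2 b ⟨n, hb⟩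
        exact hm.trans (lt_ht hbm hab).le
    rw [← mul_assoc]
    constructor
    · intro i hi
      rw [blk_mul_of, if_neg (by omega), ih1 i hi]
    · intro c hc
      rw [alph_mul_of] at hc
      rcases hc with hc | rfl
      · obtain ⟨n, hn, hcn⟩ := ih2 c hc
        exact ⟨n, hn, mem_blk_mul_of.2 (Or.inl hcn)⟩
      · exact ⟨_, ha, mem_blk_mul_of.2 (Or.inr ⟨rfl, rfl⟩)⟩

theorem PreservesDependence.mul_cliqueProd {φ : Monoid.End (TraceMonoid G)} {u : TraceMonoid G}
    {k : ℕ} {B : Finset A} (hB : G.IsClique (B : Set A))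
    (h : ∀ a ∈ B, ∀ c ∈ blk (φ (of G a)) 0, k ≤ ht u c) :
    (∀ i < k, blk (u * φ (cliqueProd G B hB)) i = blk u i) ∧
      ∀ a ∈ B, ∀ c ∈ alph (φ (of G a)), ∃ n ≥ k, c ∈ blk (u * φ (cliqueProd G B hB)) n := by
  classical
  induction B using Finset.induction_on with
  | empty => simp
  | insert b B hb ih =>
    obtain ⟨ih1, ih2⟩ := ih (hB.subset (by simp)) fun a ha => h a (Finset.mem_insert_of_mem ha)
    rw [cliqueProd_insert hb, map_mul, ← mul_assoc]
    set v := u * φ (cliqueProd G B (hB.subset (by simp)))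
    obtain ⟨h1, h2⟩ := blk_mul_of_le_ht (u := v) (w := φ (of G b)) (k := k) fun c hc =>
      (h b (Finset.mem_insert_self b B) c hc).trans (ht_le_ht_mul u _ c)
    refine ⟨fun i hi => (h1 i hi).trans (ih1 i hi), fun a ha c hc => ?_⟩
    rcases Finset.mem_insert.1 ha with rfl | ha
    · exact h2 c hc
    · obtain ⟨n, hn, hcn⟩ := ih2 a ha c hc
      exact ⟨n, hn, blk_subset_mul _ _ n hcn⟩

/-- A letter of block `k + 1` depends on a letter of block `k`. So each first letter of its image
depends on a letter of the image of block `k`, which sits at height at least `k`. Inductively the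
image of block `k` never reaches below height `k`. The factor `u` is there so that `φ = 1` yields
the same property of left multiplication by `u`. -/
theorem PreservesDependence.blk_map_pre {φ : Monoid.End (TraceMonoid G)}
    (hφ : PreservesDependence φ) (u : TraceMonoid G) (X : RealTrace G) {m k i : ℕ} (hi : i < m)
    (hmk : m ≤ k) : blk (u * φ (X.pre k)) i = blk (u * φ (X.pre m)) i := by
  have key : ∀ k, (∀ i < k, blk (u * φ (X.pre (k + 1))) i = blk (u * φ (X.pre k)) i) ∧
      ∀ a ∈ X.block k, ∀ c ∈ alph (φ (of G a)), ∃ n ≥ k, c ∈ blk (u * φ (X.pre (k + 1))) n := by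
    intro k
    induction k with
    | zero =>
      rw [RealTrace.pre_succ, map_mul, ← mul_assoc]
      exact mul_cliqueProd _ fun _ _ _ _ => Nat.zero_le _
    | succ k ih =>
      rw [RealTrace.pre_succ X (k + 1), map_mul, ← mul_assoc]
      refine mul_cliqueProd _ fun b hb c hc => ?_
      obtain ⟨a, ha, hba⟩ := X.foata k b hb
      obtain ⟨c', hc', hcc⟩ := hφ a b (fun h => hba h.symm) c hc
      obtain ⟨n, hn, hcn⟩ := ih.2 a ha c' hc'
      exact hn.trans_lt (lt_ht hcn fun h => hcc h.symm)
  induction k, hmk using Nat.le_induction with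
  | base => rfl
  | succ k hk ih => rw [(key k).1 i (by omega), ih]

theorem PreservesDependence.blk_map {φ : Monoid.End (TraceMonoid G)}
    (hφ : PreservesDependence φ) (u v : TraceMonoid G) {m i : ℕ} (hi : i < m) :
    blk (u * φ v) i = blk (u * φ (v.toReal.pre m)) i := by
  obtain ⟨N, hN⟩ := exists_pre_eq v
  rw [← hN (max N m) (le_max_left _ _)]
  rw [hφ.blk_map_pre u v.toReal hi (le_max_right _ _), hN _ (le_max_left _ _)]

theorem PreservesDependence.uniformContinuous {φ : Monoid.End (TraceMonoid G)}
    (hφ : PreservesDependence φ) : UniformContinuous φ := by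
  refine Metric.uniformContinuous_iff.2 fun ε hε => ?_
  obtain ⟨n, hn⟩ := exists_pow_lt_of_lt_one hε (by norm_num : (1 / 2 : ℝ) < 1)
  refine ⟨(1 / 2) ^ n, by positivity, fun {u v} huv => (dist_lt_iff.2 fun i hi => ?_).trans hn⟩
  rw [dist_lt_iff] at huv
  have h1 := hφ.blk_map 1 u (m := n + 1) (i := i) (by omega)
  have h2 := hφ.blk_map 1 v (m := n + 1) (i := i) (by omega)
  rw [one_mul, one_mul] at h1 h2
  rw [h1, h2, RealTrace.pre_congr fun j hj => huv j (by omega)]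

theorem le_ht_of_pow {a b : A} (h : ¬ G.Adj b a) (n : ℕ) : n ≤ ht (of G a ^ n) b := by
  have ha : ∀ n, n ≤ ht (of G a ^ n) a := by
    intro n
    induction n with
    | zero => simp
    | succ n ih =>
      rw [pow_succ]
      exact ih.trans_lt (lt_ht (mem_blk_mul_of.2 (Or.inr ⟨rfl, rfl⟩)) (G.loopless.irrefl a))
  cases n with
  | zero => simp
  | succ n =>
    rw [pow_succ]
    exact (ha n).trans_lt (lt_ht (mem_blk_mul_of.2 (Or.inr ⟨rfl, rfl⟩)) h)

theorem alph_pow_succ (u : TraceMonoid G) (n : ℕ) : alph (u ^ (n + 1)) = alph u := by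
  induction n with
  | zero => simp
  | succ n ih => rw [pow_succ, alph_mul, ih, Set.union_self]

/-- For dependent `a`, `b` the traces `aⁿ⁺¹b` and `aⁿ⁺¹` are close. If a first letter `c` of `φ b`
were adjacent to all letters of `φ a`, it would slip to the first block of `φ(aⁿ⁺¹b)`, although it
does not occur in `φ(aⁿ⁺¹)` at all, and the images would be at distance 1. -/
theorem preservesDependence_of_uniformContinuous {φ : Monoid.End (TraceMonoid G)}
    (hφ : UniformContinuous φ) : PreservesDependence φ := by
  classical
  intro a b hab c hc
  by_contra hcon
  push Not at hcon
  obtain ⟨δ, hδ, h⟩ := Metric.uniformContinuous_iff.1 hφ 1 one_pos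
  obtain ⟨n, hn⟩ := exists_pow_lt_of_lt_one hδ (by norm_num : (1 / 2 : ℝ) < 1)
  have hd : dist (of G a ^ (n + 1) * of G b) (of G a ^ (n + 1)) < δ := by
    refine lt_trans (dist_lt_iff.2 fun i hi => ?_) hn
    have := le_ht_of_pow (fun h => hab h.symm) (n + 1)
    rw [blk_mul_of, if_neg (by omega)]
  have h0 := dist_lt_iff (n := 0).1 (by simpa only [pow_zero, map_mul, map_pow] using h hd) 0 le_rfl
  have hpow := alph_pow_succ (φ (of G a)) n
  have hcomm : Commute (of G c) (φ (of G a) ^ (n + 1)) := by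
    apply commute_of_alph
    rw [hpow]
    intro x hx y hy
    rw [alph_of, Set.mem_singleton_iff] at hx
    subst hx
    exact Or.inl (hcon y hy).symm
  have hmem : c ∈ blk (φ (of G a) ^ (n + 1) * φ (of G b)) 0 := by
    obtain ⟨w, hw⟩ := of_dvd_of_mem_blk_zero hc
    apply mem_blk_zero_of_dvd
    rw [hw, ← mul_assoc, ← hcomm.eq, mul_assoc]
    exact ⟨_, rfl⟩
  rw [h0] at hmem
  have := mem_alph_of_mem_blk hmem
  rw [hpow] at this
  exact G.loopless.irrefl c (hcon c this)

end TraceMonoid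

/-! ### Real traces as suprema of traces -/

namespace RealTrace

open TraceMonoid

variable {A : Type*} {G : SimpleGraph A} {X Y : RealTrace G} {c d : ℕ → TraceMonoid G}

/-- The real trace `X` is the supremum, with respect to left divisibility, of the traces `c k`. -/
def IsSup (X : RealTrace G) (c : ℕ → TraceMonoid G) : Prop :=
  ∀ v, (∃ k, v ∣ X.pre k) ↔ ∃ k, v ∣ c k

theorem isSup_pre (X : RealTrace G) : X.IsSup X.pre := fun _ => Iff.rfl

theorem IsSup.exists_pre_dvd (h : X.IsSup c) (k : ℕ) : ∃ n, X.pre k ∣ c n :=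
  (h _).1 ⟨k, dvd_rfl⟩

theorem IsSup.exists_dvd_pre (h : X.IsSup c) (k : ℕ) : ∃ n, c k ∣ X.pre n :=
  (h _).2 ⟨k, dvd_rfl⟩

theorem IsSup.congr (h : X.IsSup c) (h1 : ∀ k, ∃ n, c k ∣ d n) (h2 : ∀ k, ∃ n, d k ∣ c n) :
    X.IsSup d := by
  intro v
  rw [h v]
  constructor
  · rintro ⟨k, hk⟩
    obtain ⟨n, hn⟩ := h1 k
    exact ⟨n, hk.trans hn⟩
  · rintro ⟨k, hk⟩
    obtain ⟨n, hn⟩ := h2 k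
    exact ⟨n, hk.trans hn⟩

theorem blk_subset_of_dvd_pre {v : TraceMonoid G} {k : ℕ} (h : v ∣ X.pre k) (i : ℕ) :
    blk v i ⊆ X.block i := by
  refine (blk_subset_of_dvd h i).trans ?_
  rw [blk_pre]
  split_ifs <;> simp

theorem eq_of_pre_dvd_pre (h1 : ∀ k, ∃ n, X.pre k ∣ Y.pre n) (h2 : ∀ k, ∃ n, Y.pre k ∣ X.pre n) :
    X = Y := by
  apply RealTrace.ext
  funext i
  apply Finset.Subset.antisymm
  · obtain ⟨n, hn⟩ := h1 (i + 1)
    have := blk_subset_of_dvd_pre hn i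
    rwa [blk_pre_of_lt _ (Nat.lt_succ_self i)] at this
  · obtain ⟨n, hn⟩ := h2 (i + 1)
    have := blk_subset_of_dvd_pre hn i
    rwa [blk_pre_of_lt _ (Nat.lt_succ_self i)] at this

theorem IsSup.eq (hX : X.IsSup c) (hY : Y.IsSup c) : X = Y := by
  refine eq_of_pre_dvd_pre (fun k => ?_) (fun k => ?_)
  · exact (hY _).2 (hX.exists_pre_dvd k)
  · exact (hX _).2 (hY.exists_pre_dvd k)

theorem IsSup.eq_of_cofinal (hX : X.IsSup c) (hY : Y.IsSup d) (h1 : ∀ k, ∃ n, c k ∣ d n)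
    (h2 : ∀ k, ∃ n, d k ∣ c n) : X = Y :=
  (hX.congr h1 h2).eq hY

theorem isSup_toReal (u : TraceMonoid G) : u.toReal.IsSup fun _ => u := by
  refine (isSup_pre _).congr (fun k => ⟨0, pre_dvd u k⟩) fun _ => ?_
  obtain ⟨N, hN⟩ := exists_pre_eq u
  exact ⟨N, by rw [hN N le_rfl]⟩

end RealTrace

/-! ### Continuous extensions and mixed products as suprema -/

namespace TraceMonoid

open RealTrace

variable {A : Type*} {G : SimpleGraph A}

/-- Since the first `m` blocks of the argument settle the first `m` blocks of the value, the limit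
can be assembled block by block. A general `f` serves both endomorphisms and left multiplications.
-/
theorem block_extend {f : TraceMonoid G → TraceMonoid G}
    (hf : ∀ v m i, i < m → blk (f v) i = blk (f (v.toReal.pre m)) i) (X : RealTrace G) {m i : ℕ}
    (hi : i < m) :
    ((isDenseInducing_toReal G).extend (fun v => (f v).toReal) X).block i =
      blk (f (X.pre m)) i := by
  have hpre : ∀ {m i : ℕ}, i < m → blk (f (X.pre m)) i = blk (f (X.pre (i + 1))) i := by
    intro m i hi
    rw [hf (X.pre m) (i + 1) i (by omega)]
    congr 2
    refine pre_congr fun j hj => ?_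
    exact blk_pre_of_lt X (by omega)
  let Y : RealTrace G :=
    { block := fun n => blk (f (X.pre (n + 1))) n
      isClique := fun n => isClique_blk _ n
      foata := fun n a ha => by
        rw [← hpre (m := n + 2) (by omega)]
        exact (f (X.pre (n + 2))).toReal.foata n a ha }
  have hY : (isDenseInducing_toReal G).extend (fun v => (f v).toReal) X = Y := by
    refine (isDenseInducing_toReal G).extend_eq_of_tendsto (Metric.tendsto_nhds.2 fun ε hε => ?_)
    obtain ⟨n, hn⟩ := exists_pow_lt_of_lt_one hε (by norm_num : (1 / 2 : ℝ) < 1)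
    refine Filter.mem_comap.2 ⟨Metric.ball X ((1 / 2) ^ n), Metric.ball_mem_nhds _ (by positivity),
      fun v hv => lt_trans (RealTrace.dist_lt_iff.2 fun i hi => ?_) hn⟩
    have hv' := RealTrace.dist_lt_iff.1 (show dist v.toReal X < _ from hv)
    change blk (f v) i = blk (f (X.pre (i + 1))) i
    rw [hf v (i + 1) i (by omega), pre_congr fun j hj => hv' j (by omega)]
  rw [hY, hpre hi]

/-- The first `m` blocks of the limit are those of `f (X.pre m)`. As truncation is monotone, each `f
(X.pre k)` divides a later prefix of the limit, so the two chains are cofinal in each other. -/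
theorem isSup_extend {f : TraceMonoid G → TraceMonoid G}
    (hf : ∀ v m i, i < m → blk (f v) i = blk (f (v.toReal.pre m)) i)
    (hmono : ∀ u v, u ∣ v → f u ∣ f v) {X : RealTrace G} {c : ℕ → TraceMonoid G}
    (hX : X.IsSup c) :
    ((isDenseInducing_toReal G).extend (fun v => (f v).toReal) X).IsSup (f ∘ c) := by
  set Y := (isDenseInducing_toReal G).extend (fun v => (f v).toReal) X with hY
  have hpre : ∀ m, Y.pre m = (f (X.pre m)).toReal.pre m := fun m =>
    pre_congr fun i hi => block_extend hf X hi
  have h : Y.IsSup (f ∘ X.pre) := by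
    refine (isSup_pre Y).congr (fun k => ⟨k, ?_⟩) fun k => ?_
    · rw [hpre]
      exact pre_dvd _ _
    · obtain ⟨N, hN⟩ := exists_pre_eq (f (X.pre k))
      refine ⟨max N k, ?_⟩
      rw [hpre]
      change f (X.pre k) ∣ _
      have h1 := pre_dvd_pre_of_dvd (hmono _ _ (X.pre_dvd_pre (le_max_right N k))) (max N k)
      rwa [hN _ (le_max_left N k)] at h1
  refine h.congr (fun k => ?_) fun k => ?_
  · obtain ⟨n, hn⟩ := hX.exists_pre_dvd k
    exact ⟨n, hmono _ _ hn⟩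
  · obtain ⟨n, hn⟩ := hX.exists_dvd_pre k
    exact ⟨n, hmono _ _ hn⟩

theorem isSup_extension {φ : Monoid.End (TraceMonoid G)} (hφ : PreservesDependence φ)
    {X : RealTrace G} {c : ℕ → TraceMonoid G} (hX : X.IsSup c) :
    (extension φ X).IsSup fun k => φ (c k) := by
  refine isSup_extend (f := φ) (fun v m i hi => ?_) (fun u v => map_dvd φ) hX
  simpa using hφ.blk_map 1 v hi

theorem preservesDependence_id : PreservesDependence (1 : Monoid.End (TraceMonoid G)) := by
  intro a b hab c hc
  refine ⟨a, by simp, ?_⟩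
  have hcb : c ∈ alph (of G b) := mem_alph_of_mem_blk hc
  rw [alph_of, Set.mem_singleton_iff] at hcb
  rwa [hcb]

theorem isSup_mixedMul (u : TraceMonoid G) {X : RealTrace G} {c : ℕ → TraceMonoid G}
    (hX : X.IsSup c) : (mixedMul u X).IsSup fun k => u * c k :=
  isSup_extend (f := fun v => u * v)
    (fun v _ _ hi => preservesDependence_id.blk_map u v hi) (fun _ _ h => mul_dvd_mul_left u h) hX

theorem mixedMul_mul (u v : TraceMonoid G) (X : RealTrace G) :
    mixedMul (u * v) X = mixedMul u (mixedMul v X) := by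
  have h := isSup_mixedMul (u * v) (isSup_pre X)
  simp only [mul_assoc] at h
  exact h.eq (isSup_mixedMul u (isSup_mixedMul v (isSup_pre X)))

theorem extension_mixedMul {φ : Monoid.End (TraceMonoid G)} (hφ : PreservesDependence φ)
    (u : TraceMonoid G) (X : RealTrace G) :
    extension φ (mixedMul u X) = mixedMul (φ u) (extension φ X) := by
  have h := isSup_extension hφ (isSup_mixedMul u (isSup_pre X))
  simp only [map_mul] at h
  exact h.eq (isSup_mixedMul _ (isSup_extension hφ (isSup_pre X)))

/-- Left cancellation in the trace monoid, applied to members of the two chains. -/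
theorem mixedMul_cancel {u : TraceMonoid G} {X Y : RealTrace G}
    (h : mixedMul u X = mixedMul u Y) : X = Y := by
  have key : ∀ {X Y : RealTrace G}, mixedMul u X = mixedMul u Y → ∀ k, ∃ n, X.pre k ∣ Y.pre n := by
    intro X Y h k
    obtain ⟨n, hn⟩ := (isSup_mixedMul u (isSup_pre X)).exists_dvd_pre k
    rw [h] at hn
    obtain ⟨m, w, hm⟩ := (isSup_mixedMul u (isSup_pre Y) _).1 ⟨n, hn⟩
    rw [mul_assoc] at hm
    exact ⟨m, w, mul_left_cancel hm⟩
  exact eq_of_pre_dvd_pre (key h) (key h.symm)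

end TraceMonoid

/-! ### An endomorphism with uncountably many exceptional infinite fixed points -/

namespace TraceMonoid

variable {A : Type*} {G : SimpleGraph A}

instance [Countable A] : Countable (TraceMonoid G) :=
  haveI : Countable (FreeMonoid A) := inferInstanceAs (Countable (List A))
  (PresentedMonoid.surjective_mk (rels := TraceRel G)).countable

/-- Infinite traces enter only through finite sets and are then only multiplied by elements of a
countable monoid. -/
theorem _root_.IsMPRational.countable [Countable A] {Y : Set (RealTrace G)} (h : IsMPRational Y) :
    Y.Countable := by
  induction h with
  | finite h => exact h.countable
  | union _ _ hY hZ => exact hY.union hZ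
  | product _ _ _ _ => exact (Set.to_countable _).image _
  | star _ _ => exact (Set.to_countable _).image _
  | mixed _ _ _ _ hY => exact (Set.to_countable _).image2 hY _

/-- The endomorphism that squares the letter `b` and fixes the other letters. -/
noncomputable def squareLetter (G : SimpleGraph A) (b : A) : Monoid.End (TraceMonoid G) :=
  open Classical in
  lift (fun x => if x = b then of G x * of G x else of G x) fun x y h => by
    have h' := of_commute h
    split_ifs <;> simp [h', Commute.mul_left, Commute.mul_right]

theorem squareLetter_self (b : A) : squareLetter G b (of G b) = of G b * of G b := by
  refine (lift_of _ _ b).trans ?_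
  simp

theorem squareLetter_of_ne {b x : A} (h : x ≠ b) : squareLetter G b (of G x) = of G x := by
  refine (lift_of _ _ x).trans ?_
  simp [h]

theorem alph_squareLetter (b x : A) : alph (squareLetter G b (of G x)) = {x} := by
  rcases eq_or_ne x b with rfl | h
  · simp [squareLetter_self]
  · simp [squareLetter_of_ne h]

theorem preservesDependence_squareLetter (b : A) : PreservesDependence (squareLetter G b) := by
  intro x y hxy c hc
  refine ⟨x, by simp [alph_squareLetter], ?_⟩
  have := mem_alph_of_mem_blk hc
  rw [alph_squareLetter, Set.mem_singleton_iff] at this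
  rwa [this]

/-- The strict inequality shows that a finite fixed point does not contain `b`. -/
theorem length_squareLetter (b : A) (u : TraceMonoid G) :
    length u ≤ length (squareLetter G b u) ∧
      (b ∈ alph u → length u < length (squareLetter G b u)) := by
  induction u using induction_right with
  | one => simp
  | mul_of u x ih =>
    rcases eq_or_ne x b with rfl | h
    · rw [map_mul, squareLetter_self]
      simp only [length_mul, length_of]
      have := ih.1
      exact ⟨by omega, fun _ => by omega⟩
    · rw [map_mul, squareLetter_of_ne h, alph_mul_of]
      simp only [length_mul, length_of, Set.mem_union, Set.mem_singleton_iff, h.symm, or_false]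
      exact ⟨by have := ih.1; omega, fun hb => by have := ih.2 hb; omega⟩

/-! ### Continuum many fixed points from an induced path on three vertices -/

section Path

variable {a b c : A}

open Classical in
/-- The real trace with blocks `{a, b}` or `{b, c}`, chosen according to `w`, where `b` is adjacent
to the nonadjacent vertices `a` and `c`. -/
noncomputable def pathTrace (hab : G.Adj a b) (hbc : G.Adj b c) (hac : ¬ G.Adj a c)
    (w : ℕ → Bool) : RealTrace G :=
  { block := fun n => {b, if w n then a else c}
    isClique := fun n => by
      split_ifs <;> simp [SimpleGraph.isClique_iff, Set.pairwise_insert, hab, hab.symm, hbc,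
        hbc.symm]
    foata := fun n x hx => by
      rcases Finset.mem_insert.1 hx with rfl | hx
      · exact ⟨x, by simp, G.loopless.irrefl x⟩
      · refine ⟨if w n then a else c, by simp, ?_⟩
        rw [Finset.mem_singleton.1 hx]
        split_ifs
        · exact G.loopless.irrefl a
        · exact hac
        · exact fun h => hac h.symm
        · exact G.loopless.irrefl c }

theorem pathTrace_pre_succ (hab : G.Adj a b) (hbc : G.Adj b c) (hac : ¬ G.Adj a c) (w : ℕ → Bool)
    (n : ℕ) : (pathTrace hab hbc hac w).pre (n + 1) =
      (pathTrace hab hbc hac w).pre n * of G (if w n then a else c) * of G b := by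
  classical
  have hb : b ∉ ({if w n then a else c} : Finset A) := by
    split_ifs <;> simp [hab.ne', hbc.ne]
  rw [RealTrace.pre_succ, mul_assoc]
  congr 1
  rw [cliqueProd_congr (C := insert b {if w n then a else c})
    (hC := by
      split_ifs <;> simp [SimpleGraph.isClique_iff, Set.pairwise_insert, hab, hab.symm, hbc,
        hbc.symm]) (by simp [pathTrace]), cliqueProd_insert hb]
  congr 1

theorem commute_pathTrace_pre (hab : G.Adj a b) (hbc : G.Adj b c) (hac : ¬ G.Adj a c)
    (w : ℕ → Bool) (n : ℕ) : Commute (of G b) ((pathTrace hab hbc hac w).pre n) := by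
  apply commute_of_alph
  rintro x hx y ⟨i, hy⟩
  rw [alph_of, Set.mem_singleton_iff] at hx
  subst hx
  rw [RealTrace.blk_pre] at hy
  split_ifs at hy
  · simp only [pathTrace, Finset.mem_insert, Finset.mem_singleton] at hy
    rcases hy with rfl | rfl
    · simp
    · split_ifs
      · exact Or.inl hab.symm
      · exact Or.inl hbc
  · simp at hy

theorem squareLetter_pathTrace_pre (hab : G.Adj a b) (hbc : G.Adj b c) (hac : ¬ G.Adj a c)
    (w : ℕ → Bool) (n : ℕ) : squareLetter G b ((pathTrace hab hbc hac w).pre n) =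
      of G b ^ n * (pathTrace hab hbc hac w).pre n := by
  induction n with
  | zero => simp
  | succ n ih =>
    have hne : (if w n then a else c) ≠ b := by
      split_ifs
      · exact hab.ne
      · exact hbc.ne'
    have hcomm : Commute (of G b)
        ((pathTrace hab hbc hac w).pre n * of G (if w n then a else c)) := by
      refine (commute_pathTrace_pre hab hbc hac w n).mul_right ?_
      split_ifs
      · exact of_commute hab.symm
      · exact of_commute hbc
    rw [pathTrace_pre_succ, map_mul, map_mul, ih, squareLetter_of_ne hne, squareLetter_self,
      pow_succ]
    have h := congrArg (fun x => of G b ^ n * x * of G b) hcomm.eq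
    simp only [mul_assoc] at h ⊢
    exact h.symm

/-- The next `m` blocks contain `m` further letters `b`, and these commute with everything in the
prefix. -/
theorem pow_mul_pathTrace_pre_dvd (hab : G.Adj a b) (hbc : G.Adj b c) (hac : ¬ G.Adj a c)
    (w : ℕ → Bool) (n m : ℕ) : of G b ^ m * (pathTrace hab hbc hac w).pre n ∣
      (pathTrace hab hbc hac w).pre (n + m) := by
  induction m with
  | zero => simp
  | succ m ih =>
    obtain ⟨r, hr⟩ := ih
    have hcomm := commute_pathTrace_pre hab hbc hac w (n + m)
    have hcomm' := commute_pathTrace_pre hab hbc hac w (n + m + 1)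
    refine ⟨r * of G (if w (n + m) then a else c), ?_⟩
    rw [← add_assoc, pathTrace_pre_succ] at *
    have : of G b * ((pathTrace hab hbc hac w).pre (n + m) * of G (if w (n + m) then a else c)) =
        (pathTrace hab hbc hac w).pre (n + m) * of G (if w (n + m) then a else c) * of G b := by
      apply mul_right_cancel (b := of G b)
      rw [← hcomm'.eq, mul_assoc]
    rw [← this, hr, pow_succ']
    simp only [mul_assoc]

/-- The image of the prefix with `n` blocks is a multiple of that prefix and divides the one with
`2n` blocks, so the chain and its image have the same supremum. -/
theorem extension_pathTrace (hab : G.Adj a b) (hbc : G.Adj b c) (hac : ¬ G.Adj a c)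
    (w : ℕ → Bool) : extension (squareLetter G b) (pathTrace hab hbc hac w) =
      pathTrace hab hbc hac w := by
  refine (isSup_extension (preservesDependence_squareLetter b)
    (RealTrace.isSup_pre _)).eq_of_cofinal (RealTrace.isSup_pre _) (fun n => ?_) fun n => ?_
  · rw [squareLetter_pathTrace_pre]
    exact ⟨n + n, pow_mul_pathTrace_pre_dvd hab hbc hac w n n⟩
  · refine ⟨n, ?_⟩
    rw [squareLetter_pathTrace_pre, ((commute_pathTrace_pre hab hbc hac w n).pow_left n).eq]
    exact ⟨_, rfl⟩

theorem pathTrace_notMem_closure (hab : G.Adj a b) (hbc : G.Adj b c) (hac : ¬ G.Adj a c)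
    (w : ℕ → Bool) : pathTrace hab hbc hac w ∉
      closure (toReal '' Function.fixedPoints (squareLetter G b)) := by
  intro h
  -- Distance less than 1 already forces equal first blocks, and the first block of the path trace
  -- contains `b`.
  obtain ⟨_, ⟨u, hu, rfl⟩, hd⟩ := Metric.mem_closure_iff.1 h 1 one_pos
  have h0 := RealTrace.dist_lt_iff (n := 0).1 (by simpa using hd) 0 le_rfl
  have hb : b ∈ blk u 0 := by
    change b ∈ u.toReal.block 0
    rw [← h0]
    simp [pathTrace]
  have := (length_squareLetter b u).2 (mem_alph_of_mem_blk hb)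
  rw [show squareLetter G b u = u from hu] at this
  exact lt_irrefl _ this

theorem pathTrace_injective (hab : G.Adj a b) (hbc : G.Adj b c) (hac : ¬ G.Adj a c) (hne : a ≠ c) :
    Function.Injective (pathTrace hab hbc hac) := by
  intro w w' h
  funext n
  have hn := congrArg (fun X => a ∈ X.block n) h
  simp only [pathTrace, Finset.mem_insert, Finset.mem_singleton, hab.ne, false_or, eq_iff_iff] at hn
  cases h1 : w n <;> cases h2 : w' n <;> simp_all

/-- The fixed points of the extension of `squareLetter G b` are not of the form
`closure (Fix φ) ∪ Y` with `Y` mp-rational if `b` is adjacent to two nonadjacent vertices. -/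
theorem fixedPoints_squareLetter_ne [Countable A] (hab : G.Adj a b) (hbc : G.Adj b c)
    (hac : ¬ G.Adj a c) (hne : a ≠ c) {Y : Set (RealTrace G)} (hY : IsMPRational Y) :
    Function.fixedPoints (extension (squareLetter G b)) ≠
      closure (toReal '' Function.fixedPoints (squareLetter G b)) ∪ Y := by
  intro h
  have hmaps : Set.MapsTo (pathTrace hab hbc hac) Set.univ Y := by
    intro w _
    have : pathTrace hab hbc hac w ∈ Function.fixedPoints (extension (squareLetter G b)) :=
      extension_pathTrace hab hbc hac w
    rw [h] at this
    exact this.resolve_left (pathTrace_notMem_closure hab hbc hac w)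
  have hc := hmaps.countable_of_injOn (pathTrace_injective hab hbc hac hne).injOn hY.countable
  rw [Set.countable_univ_iff] at hc
  rw [← Cardinal.mk_le_aleph0_iff] at hc
  simp at hc
  exact Cardinal.aleph0_lt_continuum.not_ge hc

end Path

/-- If the fixed points of all uniformly continuous endomorphisms are the expected ones, then
`I ∪ Δ` is transitive. -/
theorem transitive_of_fixedPoints [Countable A]
    (h : ∀ φ : Monoid.End (TraceMonoid G), UniformContinuous φ →
      ∃ Y : Set (RealTrace G), IsMPRational Y ∧
        Function.fixedPoints (extension φ) =
          closure (toReal '' Function.fixedPoints φ) ∪ Y)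
    (a b c : A) (hab : G.Adj a b ∨ a = b) (hbc : G.Adj b c ∨ b = c) : G.Adj a c ∨ a = c := by
  rcases hab with hab | rfl
  · rcases hbc with hbc | rfl
    · by_contra hac
      push Not at hac
      obtain ⟨Y, hY, hfix⟩ := h _ (preservesDependence_squareLetter b).uniformContinuous
      exact fixedPoints_squareLetter_ne hab hbc hac.1 hac.2 hY hfix
    · exact Or.inl hab
  · exact hbc

end TraceMonoid

/-! ### Free products of free commutative monoids -/

theorem pairwise_commute_powersHom {ι M : Type*} [Monoid M] {x : ι → M}
    (h : Pairwise fun i j => Commute (x i) (x j)) :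
    Pairwise fun i j => ∀ m n, Commute (powersHom M (x i) m) (powersHom M (x j) n) := by
  intro i j hij m n
  simp only [powersHom_apply]
  exact (h hij).pow_pow _ _

/-- The homomorphism from a free commutative monoid that is given by commuting elements. -/
noncomputable def piPowHom {ι M : Type*} [Fintype ι] [Monoid M] (x : ι → M)
    (h : Pairwise fun i j => Commute (x i) (x j)) : Multiplicative (ι → ℕ) →* M :=
  (MonoidHom.noncommPiCoprod (N := fun _ : ι => Multiplicative ℕ) (fun i => powersHom M (x i))
    (pairwise_commute_powersHom h)).comp
  { toFun := fun f i => Multiplicative.ofAdd (f.toAdd i)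
    map_one' := rfl
    map_mul' := fun _ _ => rfl }

theorem piPowHom_single {ι M : Type*} [Fintype ι] [DecidableEq ι] [Monoid M] (x : ι → M)
    (h : Pairwise fun i j => Commute (x i) (x j)) (i : ι) :
    piPowHom x h (Multiplicative.ofAdd (Pi.single i 1)) = x i := by
  have : (fun j => Multiplicative.ofAdd ((Pi.single i 1 : ι → ℕ) j)) =
      Pi.mulSingle (M := fun _ => Multiplicative ℕ) i (Multiplicative.ofAdd 1) := by
    funext j
    rcases eq_or_ne j i with rfl | hj
    · simp
    · simp [hj]
  simp only [piPowHom, MonoidHom.comp_apply, MonoidHom.coe_mk, OneHom.coe_mk, toAdd_ofAdd]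
  rw [this, MonoidHom.noncommPiCoprod_mulSingle]
  simp

theorem piPowHom_mem {ι M : Type*} [Fintype ι] [Monoid M] {x : ι → M}
    {h : Pairwise fun i j => Commute (x i) (x j)} {N : Submonoid M} (hN : ∀ i, x i ∈ N)
    (f : Multiplicative (ι → ℕ)) : piPowHom x h f ∈ N :=
  Submonoid.noncommProd_mem _ _ _ (fun _ _ _ _ hij => pairwise_commute_powersHom h hij _ _)
    fun i _ => pow_mem (hN i) _

/-! ### Comparison of trace monoids with free products -/

namespace TraceMonoid

variable {A : Type*} {G : SimpleGraph A}

/-- Both letters divide `ab` on the left, so both lie in its first block, which is a clique. -/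
theorem adj_or_eq_of_commute {a b : A} (h : Commute (of G a) (of G b)) : G.Adj a b ∨ a = b := by
  by_contra hc
  push Not at hc
  have h1 : a ∈ blk (of G a * of G b) 0 := mem_blk_zero_of_dvd ⟨_, rfl⟩
  have h2 : b ∈ blk (of G a * of G b) 0 := mem_blk_zero_of_dvd ⟨_, h.eq⟩
  exact hc.1 (isClique_blk _ 0 h1 h2 hc.2)

/-- The trace monoid of a disjoint union of complete graphs is a free product of free commutative
monoids. -/
noncomputable def equivCoprodI {n : ℕ} {k : Fin n → ℕ}
    (e : G ≃g disjointUnionComplete fun i => Fin (k i)) :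
    TraceMonoid G ≃* Monoid.CoprodI fun i => Multiplicative (Fin (k i) →₀ ℕ) :=
  let gen : (Σ i, Fin (k i)) → Monoid.CoprodI fun i => Multiplicative (Fin (k i) →₀ ℕ) :=
    fun x => Monoid.CoprodI.of (i := x.1) (Multiplicative.ofAdd (Finsupp.single x.2 1))
  let f : TraceMonoid G →* Monoid.CoprodI fun i => Multiplicative (Fin (k i) →₀ ℕ) :=
    lift (fun a => gen (e a)) fun a b h => by
      have h1 : (e a).1 = (e b).1 := ((e.map_adj_iff).2 h).2
      generalize e a = x at h1
      generalize e b = y at h1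
      obtain ⟨i, x⟩ := x
      obtain ⟨j, y⟩ := y
      obtain rfl : i = j := h1
      exact (Commute.all _ _).map Monoid.CoprodI.of
  let toPi (i : Fin n) : Multiplicative (Fin (k i) →₀ ℕ) →* Multiplicative (Fin (k i) → ℕ) :=
    { toFun := fun f => Multiplicative.ofAdd (⇑f.toAdd)
      map_one' := rfl
      map_mul' := fun _ _ => rfl }
  have hcomm (i : Fin n) :
      Pairwise fun j j' => Commute (of G (e.symm ⟨i, j⟩)) (of G (e.symm ⟨i, j'⟩)) :=
    fun j j' h => of_commute ((e.symm.map_adj_iff).2 ⟨fun h' => h (by simpa using h'), rfl⟩)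
  let g : (Monoid.CoprodI fun i => Multiplicative (Fin (k i) →₀ ℕ)) →* TraceMonoid G :=
    Monoid.CoprodI.lift fun i => (piPowHom (fun j => of G (e.symm ⟨i, j⟩)) (hcomm i)).comp (toPi i)
  have hg : ∀ x, g (gen x) = of G (e.symm x) := fun x => by
    refine (Monoid.CoprodI.lift_of _ _).trans ?_
    have h : toPi x.1 (Multiplicative.ofAdd (Finsupp.single x.2 1)) =
        Multiplicative.ofAdd (Pi.single x.2 1) :=
      congrArg Multiplicative.ofAdd (Finsupp.single_eq_pi_single _ _)
    rw [MonoidHom.comp_apply, h, piPowHom_single]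
  have hf : ∀ a, f (of G a) = gen (e a) := fun a => lift_of _ _ a
  MonoidHom.toMulEquiv f g
    (hom_ext fun a => by simp [hf, hg])
    (Monoid.CoprodI.ext_hom _ _ fun i => by
      refine Finsupp.mulHom_ext' fun j => MonoidHom.ext_mnat ?_
      have h := hg ⟨i, j⟩
      change f (g (gen ⟨i, j⟩)) = gen ⟨i, j⟩
      rw [h, hf]
      simp)

/-- Splitting off a generator on the left is what identifies the image of a letter, which cannot be
factored further. -/
theorem coprodI_eq_one_or {ι : Type*} {k : ι → Type*}
    (y : Monoid.CoprodI fun i => Multiplicative (k i →₀ ℕ)) :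
    y = 1 ∨ ∃ i j z, y = Monoid.CoprodI.of (M := fun i => Multiplicative (k i →₀ ℕ)) (i := i)
      (Multiplicative.ofAdd (Finsupp.single j 1)) * z := by
  classical
  induction y using Monoid.CoprodI.induction_on with
  | one => exact Or.inl rfl
  | of i m =>
    by_cases hm : m.toAdd = 0
    · left
      rw [show m = 1 from hm, map_one]
    · right
      obtain ⟨j, hj⟩ := Finsupp.ne_iff.1 hm
      refine ⟨i, j, Monoid.CoprodI.of (i := i)
        (Multiplicative.ofAdd (m.toAdd - Finsupp.single j 1)), ?_⟩
      rw [← map_mul, ← ofAdd_add, add_tsub_cancel_of_le]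
      · rfl
      · rw [Finsupp.single_le_iff]
        exact Nat.one_le_iff_ne_zero.2 hj
  | mul x y hx hy =>
    rcases hx with rfl | ⟨i, j, z, rfl⟩
    · simpa using hy
    · exact Or.inr ⟨i, j, z * y, mul_assoc _ _ _⟩

/-- By length, a letter is not a product of two nontrivial elements, so `e` sends it to a basis
element of one factor. The homomorphism `d` replaces every basis element by the index of its factor.
Letters that commute have commuting indices in a free monoid, so these are equal; hence
adjacency-or-equality means lying in the same factor. -/
theorem transitive_of_equivCoprodI {ι : Type*} {k : ι → Type*}
    (e : TraceMonoid G ≃* Monoid.CoprodI fun i => Multiplicative (k i →₀ ℕ))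
    (a b c : A) (hab : G.Adj a b ∨ a = b) (hbc : G.Adj b c ∨ b = c) : G.Adj a c ∨ a = c := by
  classical
  let d : (Monoid.CoprodI fun i => Multiplicative (k i →₀ ℕ)) →* FreeMonoid ι :=
    Monoid.CoprodI.lift fun i =>
      (powersHom _ (FreeMonoid.of i)).comp (AddMonoidHom.toMultiplicative Finsupp.degree)
  have hd : ∀ i (j : k i), d (Monoid.CoprodI.of (M := fun i => Multiplicative (k i →₀ ℕ)) (i := i)
      (Multiplicative.ofAdd (Finsupp.single j 1))) = FreeMonoid.of i := by
    intro i j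
    refine (Monoid.CoprodI.lift_of _ _).trans ?_
    simp
  have hgen : ∀ a : A, ∃ i, ∃ j : k i, e (of G a) =
      Monoid.CoprodI.of (M := fun i => Multiplicative (k i →₀ ℕ)) (i := i)
        (Multiplicative.ofAdd (Finsupp.single j 1)) := by
    intro a
    rcases coprodI_eq_one_or (e (of G a)) with h | ⟨i, j, z, h⟩
    · rw [map_eq_one_iff e e.injective] at h
      simpa using congrArg length h
    · refine ⟨i, j, ?_⟩
      have h1 := congrArg e.symm h
      rw [e.symm_apply_apply, map_mul] at h1
      have h2 := congrArg length h1
      rw [length_mul, length_of] at h2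
      have h3 : length (e.symm (Monoid.CoprodI.of (M := fun i => Multiplicative (k i →₀ ℕ)) (i := i)
          (Multiplicative.ofAdd (Finsupp.single j 1)))) ≠ 0 := by
        intro h0
        rw [length_eq_zero, map_eq_one_iff e.symm e.symm.injective] at h0
        have := congrArg d h0
        rw [hd, map_one] at this
        simpa using congrArg FreeMonoid.length this
      have h4 : length (e.symm z) = 0 := by omega
      rw [length_eq_zero, map_eq_one_iff e.symm e.symm.injective] at h4
      rw [h, h4, mul_one]
  have hiff : ∀ a b : A, ∀ i i', ∀ (j : k i) (j' : k i'),
      e (of G a) = Monoid.CoprodI.of (M := fun i => Multiplicative (k i →₀ ℕ)) (i := i)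
        (Multiplicative.ofAdd (Finsupp.single j 1)) →
      e (of G b) = Monoid.CoprodI.of (M := fun i => Multiplicative (k i →₀ ℕ)) (i := i')
        (Multiplicative.ofAdd (Finsupp.single j' 1)) →
      ((G.Adj a b ∨ a = b) ↔ i = i') := by
    intro a b i i' j j' ha hb
    constructor
    · intro h
      have hc : Commute (of G a) (of G b) := by
        rcases h with h | rfl
        · exact of_commute h
        · exact Commute.refl _
      have hc' := congrArg (fun x => d (e x)) hc.eq
      simp only [map_mul, ha, hb, hd] at hc'
      have := congrArg FreeMonoid.toList hc'
      simp only [FreeMonoid.toList_mul, FreeMonoid.toList_of] at this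
      simpa using (List.cons.inj this).1
    · rintro rfl
      apply adj_or_eq_of_commute
      apply e.injective
      rw [map_mul, map_mul, ha, hb]
      exact ((Commute.all _ _).map Monoid.CoprodI.of).eq
  obtain ⟨i, j, ha⟩ := hgen a
  obtain ⟨i', j', hb⟩ := hgen b
  obtain ⟨i'', j'', hc⟩ := hgen c
  rw [hiff a b i i' j j' ha hb] at hab
  rw [hiff b c i' i'' j' j'' hb hc] at hbc
  rw [hiff a c i i'' j j'' ha hc]
  exact hab.trans hbc

end TraceMonoid

/-- A finite graph in which adjacency or equality is transitive is a disjoint union of complete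
graphs. -/
theorem SimpleGraph.exists_iso_disjointUnionComplete {A : Type*} [Finite A] (G : SimpleGraph A)
    (h : ∀ a b c : A, (G.Adj a b ∨ a = b) → (G.Adj b c ∨ b = c) → (G.Adj a c ∨ a = c)) :
    ∃ (n : ℕ) (k : Fin n → ℕ), Nonempty (G ≃g disjointUnionComplete fun i => Fin (k i)) := by
  let s : Setoid A :=
    { r := fun a b => G.Adj a b ∨ a = b
      iseqv := ⟨fun a => Or.inr rfl, fun h => h.imp (fun h => h.symm) (fun h => h.symm),
        fun h1 h2 => h _ _ _ h1 h2⟩ }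
  let f : A → Fin (Nat.card (Quotient s)) := fun a => Finite.equivFin _ (Quotient.mk s a)
  let E : A ≃ Σ i, Fin (Nat.card {a // f a = i}) :=
    (Equiv.sigmaFiberEquiv f).symm.trans (Equiv.sigmaCongrRight fun i => Finite.equivFin _)
  refine ⟨_, fun i => Nat.card {a // f a = i}, ⟨⟨E, fun {a b} => ?_⟩⟩⟩
  change (E a ≠ E b ∧ f a = f b) ↔ _
  have hf : f a = f b ↔ G.Adj a b ∨ a = b :=
    ((Finite.equivFin _).injective.eq_iff).trans Quotient.eq
  rw [hf, E.injective.ne_iff]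
  constructor
  · rintro ⟨h1, h2⟩
    exact h2.resolve_right h1
  · exact fun h => ⟨h.ne, Or.inl h⟩

/-! ### Sets with the slice property are semilinear -/

section Slice

open Set Pointwise AddSubmonoid

/-- A set has the slice property if it contains `a + b + c` whenever it contains `a`, `a + b` and
`a + c`. -/
def HasSliceProperty {M : Type*} [Add M] (s : Set M) : Prop :=
  ∀ a ∈ s, ∀ b c, a + b ∈ s → a + c ∈ s → a + b + c ∈ s

namespace HasSliceProperty

theorem sep_apply_eq {ι : Type*} {M : ι → Type*} [∀ i, Add (M i)] {s : Set (∀ i, M i)}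
    (hs : HasSliceProperty s) (i : ι) (a : M i) : HasSliceProperty { x ∈ s | x i = a } := by
  intro x ⟨hx, hxi⟩ y z ⟨hxy, hxyi⟩ ⟨hxz, hxzi⟩
  refine ⟨hs _ hx _ _ hxy hxz, ?_⟩
  simp only [Pi.add_apply] at *
  rw [hxyi, ← hxi, hxzi, hxi]

variable {M : Type*} [AddCommMonoid M] [PartialOrder M] [WellQuasiOrderedLE M]
  [IsOrderedCancelAddMonoid M] [CanonicallyOrderedAdd M]

/-- For `x ∈ s` the differences `f x = {y | x + y ∈ s}` form a submonoid that grows with `x`. Where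
the ideal generated by its nonzero elements is maximal, `f x` is closed under subtraction, hence
finitely generated. -/
theorem exists_isSemilinearSet_setOfPred_le {s : Set M} (hs : HasSliceProperty s)
    (hs' : s.Nonempty) :
    ∃ x ∈ s, IsSemilinearSet { y ∈ s | x ≤ y } := by
  classical
  let f (x : M) : AddSubmonoid M :=
    if hx : x ∈ s then
      { carrier := { y | x + y ∈ s }
        zero_mem' := by simpa
        add_mem' := by
          intro a b ha hb
          simp only [mem_ofPred_eq] at *
          rw [← add_assoc]
          exact hs _ hx _ _ ha hb }
    else ⊥
  have hf : ∀ x ∈ s, ∀ y, y ∈ f x ↔ x + y ∈ s := by simp_all [f]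
  let g (x : M) : AddSemigroupIdeal M := .closure (f x \ {0})
  have hg : ∀ x ∈ s, ∀ y ∈ s, x ≤ y → g x ≤ g y := by
    intro x hx y hy hxy z hz
    rw [le_iff_exists_add] at hxy
    rcases hxy with ⟨y, rfl⟩
    simp only [AddSemigroupIdeal.mem_closure'', mem_sdiff, SetLike.mem_coe, mem_singleton_iff,
      g] at hz ⊢
    rcases hz with ⟨y', z, ⟨hz₁, hz₂⟩, rfl⟩
    rw [hf _ hx] at hz₁
    refine ⟨y', z, ⟨?_, hz₂⟩, rfl⟩
    rw [hf _ hy]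
    exact hs _ hx _ _ hy hz₁
  -- Ideals satisfy the ascending chain condition because the order is a well-quasi-order.
  rcases exists_maximalFor_of_wellFoundedGT (· ∈ s) g hs' with ⟨a, ha⟩
  refine ⟨a, ha.1, ?_⟩
  convert_to IsSemilinearSet (a +ᵥ (f a : Set M))
  · ext x
    simp only [le_iff_exists_add, mem_ofPred_eq, ha.1, ↓reduceDIte, coe_set_mk,
      AddSubsemigroup.coe_set_mk, mem_vadd_set, vadd_eq_add, f]
    grind
  · refine IsSemilinearSet.vadd a (.of_fg (AddSubmonoid.fg_of_subtractive ?_))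
    intro x hx y hxy
    rw [hf _ ha.1] at hx
    rw [hf _ ha.1, ← add_assoc] at hxy
    by_cases hy : y = 0
    · simp [hy]
    -- By maximality `g (a + x) ≤ g a`, so `y = w + u` with `u ∈ f a` nonzero. Then `w` is a
    -- difference at `a + x + u`, and the same argument applies to it; the remainder `w` strictly
    -- decreases until it is zero.
    replace hy : y ∈ g (a + x) := by
      apply AddSemigroupIdeal.subset_closure
      refine Set.mem_sdiff_of_mem ?_ hy
      rwa [SetLike.mem_coe, hf _ hx]
    apply ha.2 hx (hg _ ha.1 _ hx le_self_add) at hy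
    simp only [g, AddSemigroupIdeal.mem_closure'', Set.mem_sdiff, SetLike.mem_coe,
      Set.notMem_singleton_iff] at hy
    rcases hy with ⟨w, u, ⟨hu₁, hu₂⟩, rfl⟩
    induction w using WellQuasiOrderedLE.to_wellFoundedLT.induction (α := M) generalizing u with
      | _ w ih
    by_cases hw₁ : w = 0
    · simpa [hw₁]
    have hxu : a + x + u ∈ s := hs _ ha.1 _ _ hx (by rwa [hf _ ha.1] at hu₁)
    have hw₂ : w ∈ g (a + x + u) := by
      apply AddSemigroupIdeal.subset_closure
      refine Set.mem_sdiff_of_mem ?_ hw₁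
      rwa [SetLike.mem_coe, hf _ hxu, add_assoc, add_comm u w]
    apply ha.2 hxu (hg _ ha.1 _ hxu (le_add_right le_self_add)) at hw₂
    simp only [g, AddSemigroupIdeal.mem_closure'', Set.mem_sdiff, SetLike.mem_coe,
      Set.notMem_singleton_iff] at hw₂
    rcases hw₂ with ⟨w', u', ⟨hu'₁, hu'₂⟩, rfl⟩
    rw [add_assoc]
    apply ih
    · exact lt_add_of_pos_right _ (pos_of_ne_zero hu'₂)
    · exact add_mem hu'₁ hu₁
    · simp [hu₂, hu'₂]
    · rwa [← add_assoc w']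

end HasSliceProperty

/-- Induction on the set `t` of coordinates that may vary. Outside the semilinear part above `x`,
some coordinate in `t` is smaller than that of `x`; fixing its value leaves finitely many slices
with fewer free coordinates. -/
theorem Nat.isSemilinearSet_of_hasSliceProperty {ι : Type*} [Finite ι] {s : Set (ι → ℕ)}
    (hs : HasSliceProperty s) : IsSemilinearSet s := by
  classical
  suffices h : ∀ (a : ι → ℕ) (t : Finset ι), (∀ x ∈ s, ∀ i ∉ t, x i = a i) → IsSemilinearSet s by
    have := Fintype.ofFinite ι
    exact h 0 Finset.univ (by simp)
  intro a t ht
  induction t using Finset.strongInductionOn generalizing s a with | _ t ih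
  obtain rfl | hs' := s.eq_empty_or_nonempty
  · exact .empty
  rcases hs.exists_isSemilinearSet_setOfPred_le hs' with ⟨x, hx, hx'⟩
  convert_to IsSemilinearSet ({ y ∈ s | x ≤ y } ∪ ⋃ i ∈ t, ⋃ j ∈ Finset.range (x i),
    { y ∈ s | y i = j })
  · ext y
    simp only [Finset.mem_range, mem_union, mem_ofPred_eq, mem_iUnion, Pi.le_def]
    grind
  · refine hx'.union (.biUnion_finset fun i hi => .biUnion_finset fun j hj => ?_)
    simp only [Finset.mem_range] at hj
    apply ih _ (Finset.erase_ssubset hi) (hs.sep_apply_eq _ _) (Function.update a i j)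
    grind [Function.update]

/-! ### Semilinearity of linear equations and preimages -/

variable {M N ι κ : Type*} [AddCommMonoid M] [AddCommMonoid N] {s s₁ s₂ : Set M}

end Slice

/-! ### Rationality of the fixed points with ultimately constant blocks -/

namespace IsMPRational

variable {A : Type*} {G : SimpleGraph A}

theorem iUnion {ι : Type*} [Finite ι] {Y : ι → Set (RealTrace G)} (h : ∀ i, IsMPRational (Y i)) :
    IsMPRational (⋃ i, Y i) := by
  have key : ∀ s : Set ι, s.Finite → IsMPRational (⋃ i ∈ s, Y i) := by
    intro s hs
    induction s, hs using Set.Finite.induction_on with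
    | empty => simpa using IsMPRational.finite Set.finite_empty
    | insert _ _ ih => rw [Set.biUnion_insert]; exact (h _).union ih
  simpa using key Set.univ Set.finite_univ

open scoped Pointwise in
/-- The image of a semilinear set of exponents is mp-rational. -/
theorem image_semilinear {ι : Type*} (θ : Multiplicative (ι → ℕ) →* TraceMonoid G)
    {F : Set (ι → ℕ)} (hF : IsSemilinearSet F) :
    IsMPRational (TraceMonoid.toReal '' ((fun f => θ (Multiplicative.ofAdd f)) '' F)) := by
  obtain ⟨S, hS, hlin, rfl⟩ := hF
  have : Finite S := hS
  rw [Set.sUnion_eq_iUnion, Set.image_iUnion, Set.image_iUnion]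
  refine iUnion fun ⟨t, ht⟩ => ?_
  obtain ⟨a, p, hp, rfl⟩ := hlin t ht
  have himage : (fun f => θ (Multiplicative.ofAdd f)) '' (a +ᵥ (AddSubmonoid.closure p : Set _)) =
      {θ (Multiplicative.ofAdd a)} *
        (Submonoid.closure ((fun f => θ (Multiplicative.ofAdd f)) '' p) : Set _) := by
    apply Set.Subset.antisymm
    · rintro _ ⟨_, ⟨x, hx, rfl⟩, rfl⟩
      refine Set.mem_mul.2 ⟨_, rfl, θ (Multiplicative.ofAdd x), ?_, (map_mul θ _ _).symm⟩
      change x ∈ AddSubmonoid.closure p at hx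
      induction hx using AddSubmonoid.closure_induction with
      | mem x hx => exact Submonoid.subset_closure ⟨x, hx, rfl⟩
      | zero =>
        rw [ofAdd_zero, map_one]
        exact Submonoid.one_mem _
      | add x y _ _ hx hy =>
        rw [ofAdd_add, map_mul]
        exact Submonoid.mul_mem _ hx hy
    · intro y hy
      obtain ⟨_, rfl, z, hz, rfl⟩ := Set.mem_mul.1 hy
      have : ∃ x ∈ AddSubmonoid.closure p, θ (Multiplicative.ofAdd x) = z := by
        clear hy
        change z ∈ Submonoid.closure _ at hz
        induction hz using Submonoid.closure_induction with
        | mem z hz =>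
          obtain ⟨x, hx, rfl⟩ := hz
          exact ⟨x, AddSubmonoid.subset_closure hx, rfl⟩
        | one => exact ⟨0, AddSubmonoid.zero_mem _, by rw [ofAdd_zero, map_one]⟩
        | mul _ _ _ _ hx hy =>
          obtain ⟨x, hx, rfl⟩ := hx
          obtain ⟨y, hy, rfl⟩ := hy
          exact ⟨x + y, AddSubmonoid.add_mem _ hx hy, by rw [ofAdd_add, map_mul]⟩
      obtain ⟨x, hx, rfl⟩ := this
      exact ⟨a + x, ⟨x, hx, rfl⟩, map_mul θ _ _⟩
  rw [himage]
  exact product (finite ((Set.finite_singleton _).image _))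
    (star (finite ((hp.image _).image _)))

end IsMPRational

/-! ### Ultimately constant real traces -/

namespace RealTrace

open TraceMonoid

variable {A : Type*} {G : SimpleGraph A}

/-- The real trace `w_S w_S w_S ⋯`. -/
def const (S : Finset A) (hS : G.IsClique (S : Set A)) : RealTrace G where
  block _ := S
  isClique _ := hS
  foata _ a ha := ⟨a, ha, G.loopless.irrefl a⟩

theorem pre_const (S : Finset A) (hS : G.IsClique (S : Set A)) (n : ℕ) :
    (const S hS).pre n = cliqueProd G S hS ^ n := by
  induction n with
  | zero => simp
  | succ n ih => rw [pre_succ, ih, pow_succ]; rfl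

theorem isSup_const (S : Finset A) (hS : G.IsClique (S : Set A)) :
    (const S hS).IsSup fun n => cliqueProd G S hS ^ n := by
  rw [show (fun n => cliqueProd G S hS ^ n) = (const S hS).pre from
    funext fun n => (pre_const S hS n).symm]
  exact isSup_pre _

theorem const_mem_boundary {S : Finset A} (hS : G.IsClique (S : Set A)) (hne : S.Nonempty) :
    const S hS ∈ boundary G := by
  rintro ⟨N, hN⟩
  exact hne.ne_empty (hN N le_rfl)

/-- The real trace obtained by deleting the first `m` blocks. -/
def drop (X : RealTrace G) (m : ℕ) : RealTrace G where
  block n := X.block (m + n)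
  isClique _ := X.isClique _
  foata n := X.foata (m + n)

theorem pre_mul_pre_drop (X : RealTrace G) (m n : ℕ) :
    X.pre m * (X.drop m).pre n = X.pre (m + n) := by
  induction n with
  | zero => simp
  | succ n ih => rw [pre_succ, ← mul_assoc, ih, ← add_assoc, pre_succ]; rfl

theorem mixedMul_pre_drop (X : RealTrace G) (m : ℕ) : mixedMul (X.pre m) (X.drop m) = X := by
  refine (isSup_mixedMul _ (isSup_pre _)).eq_of_cofinal (isSup_pre X) (fun k => ?_) fun k => ?_
  · exact ⟨m + k, by rw [pre_mul_pre_drop]⟩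
  · refine ⟨k, ?_⟩
    rw [pre_mul_pre_drop]
    exact X.pre_dvd_pre (by omega)

theorem block_nonempty_of_le (X : RealTrace G) {m n : ℕ} (h : m ≤ n) (hn : (X.block n).Nonempty) :
    (X.block m).Nonempty := by
  induction n, h using Nat.le_induction with
  | base => exact hn
  | succ n _ ih =>
    obtain ⟨a, ha⟩ := hn
    obtain ⟨b, hb, _⟩ := X.foata n a ha
    exact ih ⟨b, hb⟩

theorem block_nonempty {X : RealTrace G} (hX : ¬ X.IsFinite) (n : ℕ) : (X.block n).Nonempty := by
  by_contra h
  refine hX ⟨n, fun m hm => ?_⟩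
  by_contra hne
  exact h (X.block_nonempty_of_le hm (Finset.nonempty_iff_ne_empty.2 hne))

theorem alph_pre (X : RealTrace G) (n : ℕ) : alph (X.pre n) = ⋃ i < n, (X.block i : Set A) := by
  ext a
  simp only [alph, blk_pre, Set.mem_iUnion, Set.mem_ofPred_eq]
  constructor
  · rintro ⟨i, hi⟩
    split_ifs at hi with h
    · exact ⟨i, h, hi⟩
    · simp at hi
  · rintro ⟨i, h, hi⟩
    exact ⟨i, by rwa [if_pos h]⟩

/-- All the letters of the blocks from index `J` on are pairwise equal or adjacent. -/
def CommutesFrom (X : RealTrace G) (J : ℕ) : Prop :=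
  ∀ i ≥ J, ∀ j ≥ J, ∀ x ∈ X.block i, ∀ y ∈ X.block j, G.Adj x y ∨ x = y

/-- Among letters that are equal or adjacent, the Foata condition can only be met by equality. So
the blocks from `J` on decrease, and they are constant from one of least cardinality on. -/
theorem CommutesFrom.exists_drop_eq_const {X : RealTrace G} {J : ℕ} (h : X.CommutesFrom J) :
    ∃ N ≥ J, X.drop N = const (X.block N) (X.isClique N) := by
  have hsucc : ∀ n ≥ J, X.block (n + 1) ⊆ X.block n := by
    intro n hn a ha
    obtain ⟨b, hb, hab⟩ := X.foata n a ha
    rcases h (n + 1) (by omega) n hn a ha b hb with h' | rfl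
    · exact absurd h' hab
    · exact hb
  have hanti : ∀ m n, J ≤ m → m ≤ n → X.block n ⊆ X.block m := by
    intro m n hm hmn
    induction n, hmn using Nat.le_induction with
    | base => exact subset_rfl
    | succ n hn ih => exact (hsucc n (by omega)).trans ih
  obtain ⟨N, hN, hmin⟩ := exists_minimalFor_of_wellFoundedLT (fun n => J ≤ n)
    (fun n => (X.block n).card) ⟨J, le_rfl⟩
  refine ⟨N, hN, RealTrace.ext (funext fun n => ?_)⟩
  have hsub := hanti N (N + n) hN (by omega)
  exact Finset.eq_of_subset_of_card_le hsub (hmin (j := N + n) (show J ≤ N + n by omega)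
    (Finset.card_le_card hsub))

theorem finite_range_pre [Finite A] (n : ℕ) :
    {u : TraceMonoid G | ∃ X : RealTrace G, X.pre n = u}.Finite := by
  induction n with
  | zero => exact (Set.finite_singleton 1).subset (by rintro _ ⟨X, rfl⟩; rfl)
  | succ n ih =>
    have : Finite {B : Finset A // G.IsClique (B : Set A)} := inferInstance
    refine (ih.image2 (· * ·) (Set.finite_range
      fun B : {B : Finset A // G.IsClique (B : Set A)} => cliqueProd G B.1 B.2)).subset ?_
    rintro _ ⟨X, rfl⟩
    exact ⟨_, ⟨X, rfl⟩, _, ⟨⟨X.block n, X.isClique n⟩, rfl⟩, rfl⟩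

end RealTrace

/-! ### Fixed points whose letters commute from some block on -/

namespace TraceMonoid

open RealTrace

variable {A : Type*} {G : SimpleGraph A}

theorem exists_toReal_eq {X : RealTrace G} (hX : X.IsFinite) : ∃ u : TraceMonoid G, u.toReal = X :=
  let ⟨N, hN⟩ := hX
  ⟨X.pre N, toReal_eq ⟨N, hN, rfl⟩⟩

theorem le_length_pre {X : RealTrace G} (hX : X ∈ boundary G) (n : ℕ) : n ≤ length (X.pre n) := by
  induction n with
  | zero => simp
  | succ n ih =>
    rw [pre_succ, length_mul, length_cliqueProd]
    exact Nat.add_le_add ih (block_nonempty hX n).card_pos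

theorem length_le_of_dvd {u v : TraceMonoid G} (h : u ∣ v) : length u ≤ length v := by
  obtain ⟨w, rfl⟩ := h
  simp

theorem mixedMul_mem_boundary (u : TraceMonoid G) {X : RealTrace G} (hX : X ∈ boundary G) :
    mixedMul u X ∈ boundary G := by
  intro hfin
  obtain ⟨w, hw⟩ := exists_toReal_eq hfin
  obtain ⟨n, hn⟩ := (isSup_mixedMul u (isSup_pre X)).exists_dvd_pre (length w + 1)
  rw [← hw] at hn
  have h1 := length_le_of_dvd (hn.trans (pre_dvd w n))
  have h2 := le_length_pre hX (length w + 1)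
  rw [length_mul] at h1
  omega

theorem pow_mixedMul_const (S : Finset A) (hS : G.IsClique (S : Set A)) (n : ℕ) :
    mixedMul (cliqueProd G S hS ^ n) (const S hS) = const S hS := by
  refine (isSup_mixedMul _ (isSup_const S hS)).eq_of_cofinal (isSup_const S hS) (fun k => ?_)
    fun k => ?_
  · exact ⟨n + k, by rw [pow_add]⟩
  · exact ⟨k, by rw [← pow_add]; exact pow_dvd_pow _ (by omega)⟩

/-- The slice property of the set of exponents of the fixed points of the form `u f w_S w_S ⋯`. -/
theorem extension_mixedMul_const_slice {φ : Monoid.End (TraceMonoid G)}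
    (hφ : PreservesDependence φ) {S : Finset A} (hS : G.IsClique (S : Set A)) {V : Set A}
    (hV : ∀ a ∈ V, ∀ b ∈ V, G.Adj a b ∨ a = b) (hSV : (S : Set A) ⊆ V) {U g h : TraceMonoid G}
    (hg : alph g ⊆ V) (hh : alph h ⊆ V)
    (h1 : extension φ (mixedMul U (const S hS)) = mixedMul U (const S hS))
    (h2 : extension φ (mixedMul (U * g) (const S hS)) = mixedMul (U * g) (const S hS))
    (h3 : extension φ (mixedMul (U * h) (const S hS)) = mixedMul (U * h) (const S hS)) :
    extension φ (mixedMul (U * g * h) (const S hS)) = mixedMul (U * g * h) (const S hS) := by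
  have hcomm : ∀ {u v : TraceMonoid G}, alph u ⊆ V → alph v ⊆ V → Commute u v :=
    fun hu hv => commute_of_alph fun a ha b hb => hV a (hu ha) b (hv hb)
  set s := cliqueProd G S hS with hs
  set X := const S hS with hX
  have hsV : alph s ⊆ V := by rwa [hs, alph_cliqueProd]
  have hspow : ∀ n, alph (s ^ n) ⊆ V := by
    rintro (_ | n)
    · simp
    · rwa [alph_pow_succ]
  rw [extension_mixedMul hφ] at h1 h2 h3 ⊢
  rw [map_mul] at h2 h3
  rw [map_mul, map_mul]
  set Ξ := extension φ X with hΞ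
  have hsupΞ : Ξ.IsSup fun n => φ (s ^ n) := isSup_extension hφ (isSup_const S hS)
  -- The fixed point `U s s ⋯` is also the supremum of the chain `φ U * φ (s ^ n)`, so `U` divides
  -- one of its members; `l` is the quotient.
  obtain ⟨K, l, hl⟩ : ∃ K, U ∣ φ U * φ (s ^ K) := by
    obtain ⟨n, hn⟩ := (isSup_mixedMul U (isSup_const S hS)).exists_dvd_pre 0
    rw [pow_zero, mul_one, ← hX, ← h1] at hn
    exact (isSup_mixedMul (φ U) hsupΞ _).1 ⟨n, hn⟩
  have hdvd : ∀ {x y : TraceMonoid G}, mixedMul x Ξ = mixedMul y X → alph y ⊆ V → alph x ⊆ V := by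
    intro x y hxy hy
    obtain ⟨n, hn⟩ := (isSup_mixedMul x hsupΞ).exists_dvd_pre 0
    rw [pow_zero, map_one, mul_one, hxy] at hn
    obtain ⟨m, hm⟩ := (isSup_mixedMul y (isSup_const S hS) _).1 ⟨n, hn⟩
    refine (alph_subset_of_dvd hm).trans ?_
    rw [alph_mul]
    exact Set.union_subset hy (hspow m)
  -- `Ξ` absorbs `φ (s ^ K)`, which commutes with `φ x`. Inserting it makes the factor `U` appear on
  -- the left, and cancelling `U` turns the three hypotheses into `l Ξ = X`, `l φ(g) Ξ = g X` and `l
  -- φ(h) Ξ = h X`.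
  have hshift : ∀ {x : TraceMonoid G}, alph x ⊆ V →
      mixedMul (φ U * φ x) Ξ = mixedMul U (mixedMul (l * φ x) Ξ) := by
    intro x hx
    have hK : mixedMul (φ (s ^ K)) Ξ = Ξ := by
      rw [hΞ, ← extension_mixedMul hφ, pow_mixedMul_const]
    conv_lhs => rw [← hK]
    rw [← mixedMul_mul, ← mixedMul_mul, mul_assoc, ← map_mul, (hcomm hx (hspow K)).eq, map_mul,
      ← mul_assoc, hl, mul_assoc]
  have e1 : mixedMul l Ξ = X := by
    have := hshift (x := 1) (by simp)
    simp only [map_one, mul_one] at this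
    rw [this] at h1
    exact mixedMul_cancel h1
  have e2 : mixedMul (l * φ g) Ξ = mixedMul g X := by
    rw [hshift hg, mixedMul_mul U g] at h2
    exact mixedMul_cancel h2
  have e3 : mixedMul (l * φ h) Ξ = mixedMul h X := by
    rw [hshift hh, mixedMul_mul U h] at h3
    exact mixedMul_cancel h3
  -- So `l` and `φ h` commute with each other, and `φ h` with `g`, which gives `l φ(g) φ(h) Ξ = φ(h)
  -- g X = g φ(h) l Ξ = g h X`.
  have hlh : alph (l * φ h) ⊆ V := hdvd e3 hh
  rw [alph_mul, Set.union_subset_iff] at hlh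
  have hgh : φ g * φ h = φ h * φ g := by rw [← map_mul, ← map_mul, (hcomm hg hh).eq]
  rw [mul_assoc, ← map_mul, hshift (by rw [alph_mul]; exact Set.union_subset hg hh), mul_assoc U,
    mixedMul_mul U]
  congr 1
  rw [map_mul, hgh, ← mul_assoc, (hcomm hlh.1 hlh.2).eq, mul_assoc, mixedMul_mul, e2,
    ← mixedMul_mul, (hcomm hlh.2 hg).eq]
  conv_lhs => rw [← e1]
  rw [← mixedMul_mul, mul_assoc, ← (hcomm hlh.1 hlh.2).eq, mixedMul_mul, e3, mixedMul_mul]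

open scoped Pointwise in
/-- The fixed points `u f w_S w_S ⋯` with `f` a product of letters that are equal or adjacent to
all the elements of `S` form an mp-rational set. -/
theorem isMPRational_fixedPoints_const [Finite A] {φ : Monoid.End (TraceMonoid G)}
    (hφ : PreservesDependence φ)
    (u : TraceMonoid G) {S : Finset A} (hS : G.IsClique (S : Set A)) (hne : S.Nonempty) {V : Set A}
    (hV : ∀ a ∈ V, ∀ b ∈ V, G.Adj a b ∨ a = b) (hSV : (S : Set A) ⊆ V) :
    IsMPRational {X | extension φ X = X ∧
      ∃ f, alph f ⊆ V ∧ X = mixedMul (u * f) (const S hS)} := by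
  classical
  have : Fintype V := Fintype.ofFinite V
  let θ : Multiplicative (V → ℕ) →* TraceMonoid G := piPowHom (fun a : V => of G a.1)
    fun a b hab => of_commute ((hV a a.2 b b.2).resolve_right fun h => hab (Subtype.ext h))
  have hθ : ∀ f, alph f ⊆ V → ∃ x : V → ℕ, θ (Multiplicative.ofAdd x) = f := by
    intro f hf
    induction f using induction_right with
    | one => exact ⟨0, map_one θ⟩
    | mul_of f a ih =>
      rw [alph_mul_of, Set.union_subset_iff] at hf
      obtain ⟨x, hx⟩ := ih hf.1
      refine ⟨x + Pi.single ⟨a, hf.2 rfl⟩ 1, ?_⟩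
      rw [ofAdd_add, map_mul, hx]
      congr 1
      exact piPowHom_single _ _ _
  have hθ' : ∀ x : V → ℕ, alph (θ (Multiplicative.ofAdd x)) ⊆ V := by
    intro x
    let N : Submonoid (TraceMonoid G) :=
      { carrier := {f | alph f ⊆ V}
        one_mem' := by simp
        mul_mem' := fun {f g} hf hg => by
          change alph (f * g) ⊆ V
          rw [alph_mul]
          exact Set.union_subset hf hg }
    refine piPowHom_mem (N := N) (fun a => ?_) _
    change alph (of G a.1) ⊆ V
    simp
  let F : Set (V → ℕ) := {x | extension φ (mixedMul (u * θ (Multiplicative.ofAdd x)) (const S hS)) =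
    mixedMul (u * θ (Multiplicative.ofAdd x)) (const S hS)}
  have hF : HasSliceProperty F := by
    intro a ha b c hab hac
    change extension φ _ = _ at ha hab hac ⊢
    simp only [ofAdd_add, map_mul, ← mul_assoc] at ha hab hac ⊢
    exact extension_mixedMul_const_slice hφ hS hV hSV (hθ' b) (hθ' c) ha hab hac
  have hrat := IsMPRational.mixed (K := {u} * ((fun x => θ (Multiplicative.ofAdd x)) '' F))
    (Y := {const S hS})
    (Set.singleton_subset_iff.2 (const_mem_boundary hS hne))
    (IsMPRational.product (.finite ((Set.finite_singleton _).image _))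
      (IsMPRational.image_semilinear θ (Nat.isSemilinearSet_of_hasSliceProperty hF)))
    (.finite (Set.finite_singleton _))
  convert hrat using 1
  ext X
  constructor
  · rintro ⟨hX, f, hf, rfl⟩
    obtain ⟨x, rfl⟩ := hθ f hf
    exact ⟨_, ⟨u, rfl, _, ⟨x, hX, rfl⟩, rfl⟩, _, rfl, rfl⟩
  · rintro ⟨_, ⟨_, rfl, _, ⟨x, hx, rfl⟩, rfl⟩, _, rfl, rfl⟩
    exact ⟨hx, _, hθ' x, rfl⟩

/-- Such a fixed point is `u f w_S w_S ⋯`, where `u` collects the first `J` blocks, `S` is the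
eventual block and `f` collects the blocks in between. There are finitely many `u` and `S`, and by
transitivity the letters available for `f` commute pairwise. -/
theorem exists_isMPRational_commutesFrom [Finite A]
    (hG : ∀ a b c : A, (G.Adj a b ∨ a = b) → (G.Adj b c ∨ b = c) → (G.Adj a c ∨ a = c))
    {φ : Monoid.End (TraceMonoid G)} (hφ : PreservesDependence φ) (J : ℕ) :
    ∃ Y : Set (RealTrace G), IsMPRational Y ∧ Y ⊆ boundary G ∧
      Y ⊆ Function.fixedPoints (extension φ) ∧
      ∀ X ∈ Function.fixedPoints (extension φ), ¬ X.IsFinite → X.CommutesFrom J → X ∈ Y := by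
  have : Finite {u : TraceMonoid G // ∃ X : RealTrace G, X.pre J = u} := finite_range_pre J
  let V : Finset A → Set A := fun S => {a | ∀ s ∈ S, G.Adj a s ∨ a = s}
  let Y : {u : TraceMonoid G // ∃ X : RealTrace G, X.pre J = u} →
      {S : Finset A // G.IsClique (S : Set A) ∧ S.Nonempty} → Set (RealTrace G) :=
    fun u S => {X | extension φ X = X ∧
      ∃ f, alph f ⊆ V S.1 ∧ X = mixedMul (u.1 * f) (const S.1 S.2.1)}
  refine ⟨⋃ u, ⋃ S, Y u S, .iUnion fun u => .iUnion fun S => ?_, ?_, ?_, ?_⟩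
  · obtain ⟨S, hS, s, hs⟩ := S
    refine isMPRational_fixedPoints_const hφ _ hS ⟨s, hs⟩ (fun a ha b hb => ?_) fun a ha b hb => ?_
    · exact hG a s b (ha s hs) ((hb s hs).imp (fun h => h.symm) fun h => h.symm)
    · by_cases hab : a = b
      · exact Or.inr hab
      · exact Or.inl (hS ha hb hab)
  · refine Set.iUnion_subset fun u => Set.iUnion_subset fun S => ?_
    rintro X ⟨_, f, _, rfl⟩
    exact mixedMul_mem_boundary _ (const_mem_boundary _ S.2.2)
  · refine Set.iUnion_subset fun u => Set.iUnion_subset fun S => ?_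
    rintro X ⟨hX, _⟩
    exact hX
  · intro X hX hinf hJ
    obtain ⟨N, hN, hdrop⟩ := hJ.exists_drop_eq_const
    obtain ⟨k, rfl⟩ := Nat.exists_eq_add_of_le hN
    refine Set.mem_iUnion.2 ⟨⟨X.pre J, X, rfl⟩, Set.mem_iUnion.2
      ⟨⟨X.block (J + k), X.isClique _, block_nonempty hinf _⟩, hX, (X.drop J).pre k, ?_, ?_⟩⟩
    · rw [alph_pre]
      refine Set.iUnion₂_subset fun i hi a ha s hs => ?_
      exact hJ (J + i) (by omega) (J + k) (by omega) a ha s hs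
    · rw [pre_mul_pre_drop, ← hdrop, mixedMul_pre_drop]

end TraceMonoid

/-! ### Infinite fixed points when `I ∪ Δ` is transitive -/

namespace TraceMonoid

open RealTrace

variable {A : Type*} {G : SimpleGraph A}

theorem blk_zero_nonempty {u : TraceMonoid G} (hu : u ≠ 1) : (blk u 0).Nonempty := by
  rw [Ne, ← alph_eq_empty, ← Ne, ← Set.nonempty_iff_ne_empty] at hu
  obtain ⟨a, n, ha⟩ := hu
  exact u.toReal.block_nonempty_of_le (Nat.zero_le n) ⟨a, ha⟩

/-- If `G` is not complete, then a nontrivial uniformly continuous endomorphism erases no letter. -/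
theorem PreservesDependence.map_of_eq_one {φ : Monoid.End (TraceMonoid G)}
    (hφ : PreservesDependence φ)
    (hG : ∀ a b c : A, (G.Adj a b ∨ a = b) → (G.Adj b c ∨ b = c) → (G.Adj a c ∨ a = c))
    {p q : A} (hpq : ¬ (G.Adj p q ∨ p = q)) {x : A} (hx : φ (of G x) = 1) (y : A) :
    φ (of G y) = 1 := by
  have step : ∀ {x y : A}, φ (of G x) = 1 → ¬ G.Adj x y → φ (of G y) = 1 := by
    intro x y hx hxy
    by_contra hy
    obtain ⟨c, hc⟩ := blk_zero_nonempty hy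
    obtain ⟨c', hc', _⟩ := hφ x y hxy c hc
    rw [hx, alph_one] at hc'
    exact hc'
  -- Erasure passes to dependent letters. Adjacent letters are reached in two such steps through a
  -- letter `z` of another component.
  by_cases hxy : G.Adj x y
  · obtain ⟨z, hz⟩ : ∃ z, ¬ (G.Adj x z ∨ x = z) := by
      by_contra! hcon
      exact hpq (hG p x q ((hcon p).imp (fun h => h.symm) fun h => h.symm) (hcon q))
    refine step (step hx fun h => hz (Or.inl h)) fun h => hz ?_
    exact hG x y z (Or.inl hxy) (Or.inl h.symm)
  · exact step hx hxy

theorem extension_eq_one {φ : Monoid.End (TraceMonoid G)} (hφ : PreservesDependence φ)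
    (h : ∀ a, φ (of G a) = 1) (X : RealTrace G) :
    extension φ X = (1 : TraceMonoid G).toReal := by
  have h1 : ∀ u, φ u = 1 := by
    intro u
    induction u using induction_right with
    | one => exact map_one φ
    | mul_of u a ih => rw [map_mul, ih, h, one_mul]
  have h2 := isSup_extension hφ (isSup_pre X)
  simp only [h1] at h2
  exact h2.eq (isSup_toReal 1)

theorem length_le_length_map {φ : Monoid.End (TraceMonoid G)} (h : ∀ a, φ (of G a) ≠ 1)
    (u : TraceMonoid G) : length u ≤ length (φ u) := by
  induction u using induction_right with
  | one => simp
  | mul_of u a ih =>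
    have ha : length (φ (of G a)) ≠ 0 := fun h0 => h a (length_eq_zero.1 h0)
    rw [map_mul, length_mul, length_mul, length_of]
    omega

/-- The first `m` blocks of `X`, being those of its image, are the first `m` blocks of `φ (X.pre
m)`. -/
theorem pre_dvd_map_pre {φ : Monoid.End (TraceMonoid G)} (hφ : PreservesDependence φ)
    {X : RealTrace G} (hX : extension φ X = X) (m : ℕ) : X.pre m ∣ φ (X.pre m) := by
  have h : X.pre m = (φ (X.pre m)).toReal.pre m := by
    refine pre_congr fun i hi => ?_
    have := block_extend (f := φ) (fun v m i hi => by simpa using hφ.blk_map 1 v hi) X hi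
    exact (congrArg (fun Z => Z.block i) hX.symm).trans this
  conv_lhs => rw [h]
  exact pre_dvd _ _

/-- A fixed point of a nonerasing uniformly continuous endomorphism is a product of fixed
cliques. -/
theorem fixedPoints_eq_closure {φ : Monoid.End (TraceMonoid G)} (hφ : PreservesDependence φ)
    (hne : ∀ a, φ (of G a) ≠ 1) :
    Function.fixedPoints φ = (Submonoid.closure {u : TraceMonoid G | φ u = u ∧
      ∃ B : {B : Finset A // G.IsClique (B : Set A)}, cliqueProd G B.1 B.2 = u} :
        Set (TraceMonoid G)) := by
  apply Set.Subset.antisymm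
  · intro u hu
    change φ u = u at hu
    have hfix : extension φ u.toReal = u.toReal := by
      have h := isSup_extension hφ (isSup_toReal u)
      simp only [hu] at h
      exact h.eq (isSup_toReal u)
    -- The image of a prefix is a multiple of it, and the image of the rest is no shorter than the
    -- rest. Since the total length is preserved, neither can grow.
    have hpre : ∀ m, φ (u.toReal.pre m) = u.toReal.pre m := by
      intro m
      obtain ⟨r, hr⟩ := pre_dvd_map_pre hφ hfix m
      obtain ⟨t, ht⟩ := pre_dvd u m
      have h1 : length (φ (u.toReal.pre m)) + length (φ t) =
          length (u.toReal.pre m) + length t := by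
        rw [← length_mul, ← map_mul, ← ht, hu, ← length_mul, ← ht]
      have h2 := length_le_length_map hne t
      have h3 : length r = 0 := by
        have := congrArg length hr
        rw [length_mul] at this
        omega
      rw [hr, length_eq_zero.1 h3, mul_one]
    obtain ⟨N, hN⟩ := exists_pre_eq u
    rw [← hN N le_rfl]
    clear hN
    induction N with
    | zero => exact Submonoid.one_mem _
    | succ n ih =>
      rw [pre_succ]
      refine Submonoid.mul_mem _ ih (Submonoid.subset_closure ⟨?_, ⟨_, u.toReal.isClique n⟩, rfl⟩)
      have := hpre (n + 1)
      rw [pre_succ, map_mul, hpre n] at this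
      exact mul_left_cancel this
  · intro u hu
    change u ∈ Submonoid.closure _ at hu
    change φ u = u
    induction hu using Submonoid.closure_induction with
    | mem u hu => exact hu.1
    | one => exact map_one φ
    | mul u v _ _ hu hv => rw [map_mul, hu, hv]

theorem isMPRational_fixedPoints [Finite A] {φ : Monoid.End (TraceMonoid G)}
    (hφ : PreservesDependence φ) (hne : ∀ a, φ (of G a) ≠ 1) :
    IsMPRational (toReal '' Function.fixedPoints φ) := by
  rw [fixedPoints_eq_closure hφ hne]
  refine .star (.finite (Set.Finite.image _ ?_))
  exact (Set.finite_range fun B : {B : Finset A // G.IsClique (B : Set A)} =>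
    cliqueProd G B.1 B.2).subset fun u hu => hu.2

/-- A block of the normal form that is followed by a block of another component cannot be extended
by multiplication on the right. -/
theorem blk_eq_of_dvd
    (hG : ∀ a b c : A, (G.Adj a b ∨ a = b) → (G.Adj b c ∨ b = c) → (G.Adj a c ∨ a = c))
    {u v : TraceMonoid G} (h : u ∣ v) {j j' : ℕ} (hjj : j ≤ j') {x y : A} (hx : x ∈ blk u j)
    (hy : y ∈ blk u j') (hxy : ¬ (G.Adj x y ∨ x = y)) {i : ℕ} (hi : i ≤ j) :
    blk v i = blk u i := by
  classical
  obtain ⟨w, rfl⟩ := h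
  induction w using induction_right with
  | one => rw [mul_one]
  | mul_of w a ih =>
    rw [← mul_assoc, blk_mul_of, if_neg, ih]
    -- A letter inserted at height at most `j` would be adjacent to both `x` and `y`, which lie in
    -- different components.
    intro hia
    have h1 := adj_of_ht_le (a := a) (n := j) (by omega) (blk_subset_mul u w j hx)
    have h2 := adj_of_ht_le (a := a) (n := j') (by omega) (blk_subset_mul u w j' hy)
    exact hxy (hG x a y (Or.inl h1.symm) (Or.inl h2))

theorem block_eq_of_dvd_pre
    (hG : ∀ a b c : A, (G.Adj a b ∨ a = b) → (G.Adj b c ∨ b = c) → (G.Adj a c ∨ a = c))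
    {u : TraceMonoid G} {X : RealTrace G} {k : ℕ} (h : u ∣ X.pre k) {j j' : ℕ} (hjj : j ≤ j')
    {x y : A} (hx : x ∈ blk u j) (hy : y ∈ blk u j') (hxy : ¬ (G.Adj x y ∨ x = y)) {i : ℕ}
    (hi : i ≤ j) : X.block i = blk u i := by
  rw [← blk_eq_of_dvd hG h hjj hx hy hxy hi, blk_pre, if_pos]
  have := blk_subset_of_dvd h j hx
  rw [blk_pre] at this
  split_ifs at this
  · omega
  · simp at this

theorem length_pre_le [Fintype A] (X : RealTrace G) (k : ℕ) :
    length (X.pre k) ≤ k * Fintype.card A := by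
  induction k with
  | zero => simp
  | succ k ih =>
    rw [pre_succ, length_mul, length_cliqueProd, add_mul, one_mul]
    exact Nat.add_le_add ih (Finset.card_le_univ _)

theorem blk_nonempty_of_length [Fintype A] {u : TraceMonoid G} {k : ℕ}
    (h : k * Fintype.card A < length u) : (blk u k).Nonempty := by
  by_contra hk
  have hempty : ∀ n ≥ k, blk u n = ∅ := by
    intro n hn
    by_contra hne
    exact hk (u.toReal.block_nonempty_of_le hn (Finset.nonempty_iff_ne_empty.2 hne))
  have : u.toReal.pre k = u := by
    apply toReal_injective
    exact toReal_eq ⟨k, hempty, rfl⟩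
  have h2 := length_pre_le u.toReal k
  rw [this] at h2
  omega

/-- The infinite fixed points that begin with a given clique that is not fixed. -/
theorem exists_isMPRational_block_zero [Finite A]
    (hG : ∀ a b c : A, (G.Adj a b ∨ a = b) → (G.Adj b c ∨ b = c) → (G.Adj a c ∨ a = c))
    {φ : Monoid.End (TraceMonoid G)} (hφ : PreservesDependence φ) (hne : ∀ a, φ (of G a) ≠ 1)
    (B : Finset A) (hB : G.IsClique (B : Set A))
    (hfix : φ (cliqueProd G B hB) ≠ cliqueProd G B hB) :
    ∃ Y : Set (RealTrace G), IsMPRational Y ∧ Y ⊆ boundary G ∧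
      Y ⊆ Function.fixedPoints (extension φ) ∧
      ∀ X ∈ Function.fixedPoints (extension φ), X ∈ boundary G → X.block 0 = B → X ∈ Y := by
  have := Fintype.ofFinite A
  set w := cliqueProd G B hB with hw
  set E := {X : RealTrace G | extension φ X = X ∧ X ∈ boundary G ∧ X.block 0 = B} with hE
  rcases E.eq_empty_or_nonempty with hempty | ⟨X₀, hX₀⟩
  · refine ⟨∅, .finite Set.finite_empty, Set.empty_subset _, Set.empty_subset _,
      fun X h1 h2 h3 => ?_⟩
    rw [← hempty]
    exact ⟨h1, h2, h3⟩
  have hpre1 : ∀ X ∈ E, X.pre 1 = w := by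
    rintro X ⟨_, _, h⟩
    rw [pre_succ, pre_zero, one_mul]
    exact cliqueProd_congr h
  -- These prefixes are common to all fixed points in `E`. They grow because `φ w = w r` with `r ≠
  -- 1`, so each step appends an iterate of `r`, which is never erased.
  let v : ℕ → TraceMonoid G := fun n => φ^[n] w
  have hv : ∀ X ∈ E, ∀ n, ∃ k, v n ∣ X.pre k := by
    intro X hX n
    induction n with
    | zero => exact ⟨1, by rw [hpre1 X hX]; exact dvd_rfl⟩
    | succ n ih =>
      obtain ⟨k, hk⟩ := ih
      have h := (isSup_extension hφ (isSup_pre X)).exists_dvd_pre k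
      rw [hX.1] at h
      obtain ⟨m, hm⟩ := h
      refine ⟨m, dvd_trans ?_ hm⟩
      simp only [v, Function.iterate_succ_apply']
      exact map_dvd φ hk
  obtain ⟨r, hr⟩ : w ∣ φ w := by
    rw [← hpre1 X₀ hX₀]
    exact pre_dvd_map_pre hφ hX₀.1 1
  have hr1 : r ≠ 1 := by
    rintro rfl
    exact hfix (by rw [hr, mul_one])
  have hlen : ∀ n, n ≤ length (v n) := by
    have hrn : ∀ n, length r ≤ length (φ^[n] r) := by
      intro n
      induction n with
      | zero => exact le_rfl
      | succ n ih =>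
        rw [Function.iterate_succ_apply']
        exact ih.trans (length_le_length_map hne _)
    intro n
    induction n with
    | zero => exact Nat.zero_le _
    | succ n ih =>
      have h0 : length r ≠ 0 := fun h => hr1 (length_eq_zero.1 h)
      have h1 : v (n + 1) = v n * φ^[n] r := by
        simp only [v, Function.iterate_succ_apply]
        rw [hr]
        exact iterate_map_mul φ n w r
      rw [h1, length_mul]
      have := hrn n
      omega
  -- If letters of different components occur arbitrarily deep, the blocks below them are final, and
  -- the iterates determine the fixed point, so `E = {X₀}`. Otherwise one bound `J` serves all
  -- iterates.
  by_cases hα : ∀ J, ∃ n, ∃ j ≥ J, ∃ j' ≥ j, ∃ x ∈ blk (v n) j, ∃ y ∈ blk (v n) j',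
      ¬ (G.Adj x y ∨ x = y)
  · refine ⟨{X₀}, .finite (Set.finite_singleton _), Set.singleton_subset_iff.2 hX₀.2.1,
      Set.singleton_subset_iff.2 hX₀.1, fun X h1 h2 h3 => ?_⟩
    refine RealTrace.ext (funext fun i => ?_)
    obtain ⟨n, j, hj, j', hj', x, hx, y, hy, hxy⟩ := hα i
    obtain ⟨k, hk⟩ := hv X ⟨h1, h2, h3⟩ n
    obtain ⟨k₀, hk₀⟩ := hv X₀ hX₀ n
    rw [block_eq_of_dvd_pre hG hk hj' hx hy hxy hj, block_eq_of_dvd_pre hG hk₀ hj' hx hy hxy hj]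
  · push Not at hα
    obtain ⟨J, hJ⟩ := hα
    obtain ⟨Y, hY1, hY2, hY3, hY4⟩ := exists_isMPRational_commutesFrom hG hφ J
    refine ⟨Y, hY1, hY2, hY3, fun X h1 h2 h3 => hY4 X h1 h2 ?_⟩
    have hle : ∀ i ≥ J, ∀ j ≥ i, ∀ x ∈ X.block i, ∀ y ∈ X.block j, G.Adj x y ∨ x = y := by
      intro i hi j hj x hx y hy
      -- The first `j` blocks hold at most `j * Fintype.card A` letters, so `v n` has letters in
      -- block `j`, hence in block `i`. These represent the components of the corresponding blocks
      -- of `X`.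
      set n := j * Fintype.card A + 1 with hn
      obtain ⟨k, hk⟩ := hv X ⟨h1, h2, h3⟩ n
      obtain ⟨y', hy'⟩ := blk_nonempty_of_length (u := v n) (k := j) (by have := hlen n; omega)
      obtain ⟨x', hx'⟩ := (v n).toReal.block_nonempty_of_le hj ⟨y', hy'⟩
      have hclique : ∀ {m : ℕ} {a b : A}, a ∈ X.block m → b ∈ X.block m → G.Adj a b ∨ a = b := by
        intro m a b ha hb
        by_cases hab : a = b
        · exact Or.inr hab
        · exact Or.inl (X.isClique m ha hb hab)
      have hxy := hJ n i hi j hj x' hx' y' hy'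
      refine hG x x' y (hclique hx (blk_subset_of_dvd_pre hk i hx')) (hG x' y' y hxy
        (hclique (blk_subset_of_dvd_pre hk j hy') hy))
    intro i hi j hj x hx y hy
    rcases le_total i j with h | h
    · exact hle i hi j h x hx y hy
    · exact (hle j hj i h y hy x hx).imp (fun h => h.symm) fun h => h.symm

/-- An infinite fixed point either is a limit of finite fixed points, or arises from an infinite
fixed point that begins with a clique that is not fixed. -/
theorem mem_closure_or_exists_drop {φ : Monoid.End (TraceMonoid G)} (hφ : PreservesDependence φ)
    {X : RealTrace G} (hX : extension φ X = X) :
    X ∈ closure (toReal '' Function.fixedPoints φ) ∨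
      ∃ m, φ (X.pre m) = X.pre m ∧ extension φ (X.drop m) = X.drop m ∧
        φ (cliqueProd G _ (X.isClique m)) ≠ cliqueProd G _ (X.isClique m) := by
  classical
  by_cases hinf : ∀ m, ∃ n ≥ m, φ (X.pre n) = X.pre n
  · left
    rw [Metric.mem_closure_iff]
    intro ε hε
    obtain ⟨m, hm⟩ := exists_pow_lt_of_lt_one hε (by norm_num : (1 / 2 : ℝ) < 1)
    obtain ⟨n, hn, hfix⟩ := hinf (m + 1)
    refine ⟨_, ⟨X.pre n, hfix, rfl⟩, lt_trans (RealTrace.dist_lt_iff.2 fun i hi => ?_) hm⟩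
    exact (blk_pre_of_lt X (by omega)).symm
  · right
    push Not at hinf
    obtain ⟨M, hM⟩ := hinf
    -- The last fixed prefix; the empty prefix is always fixed, so one exists.
    set m := Nat.findGreatest (fun n => φ (X.pre n) = X.pre n) M with hm
    have hfix : φ (X.pre m) = X.pre m :=
      Nat.findGreatest_spec (P := fun n => φ (X.pre n) = X.pre n) (Nat.zero_le M) (map_one φ)
    have hnot : φ (X.pre (m + 1)) ≠ X.pre (m + 1) := by
      rcases le_or_gt (m + 1) M with h | h
      · exact Nat.findGreatest_is_greatest (P := fun n => φ (X.pre n) = X.pre n)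
          (Nat.lt_succ_self m) h
      · exact hM _ (by omega)
    refine ⟨m, hfix, ?_, fun h => hnot ?_⟩
    · have h := hX
      rw [← mixedMul_pre_drop X m, extension_mixedMul hφ, hfix] at h
      exact mixedMul_cancel h
    · rw [pre_succ, map_mul, hfix, h]

/-- If `I ∪ Δ` is transitive, then the fixed points of the extension of a uniformly continuous
endomorphism are the limits of the fixed points and an mp-rational set. -/
theorem exists_fixedPoints_extension_eq [Finite A]
    (hG : ∀ a b c : A, (G.Adj a b ∨ a = b) → (G.Adj b c ∨ b = c) → (G.Adj a c ∨ a = c))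
    {φ : Monoid.End (TraceMonoid G)} (huc : UniformContinuous φ) :
    ∃ Y : Set (RealTrace G), IsMPRational Y ∧
      Function.fixedPoints (extension φ) = closure (toReal '' Function.fixedPoints φ) ∪ Y := by
  have hφ := preservesDependence_of_uniformContinuous huc
  suffices h : ∃ Y : Set (RealTrace G), IsMPRational Y ∧
      Y ⊆ Function.fixedPoints (extension φ) ∧ ∀ X ∈ Function.fixedPoints (extension φ),
        X ∈ boundary G → X ∈ closure (toReal '' Function.fixedPoints φ) ∨ X ∈ Y by
    obtain ⟨Y, hY1, hY2, hY3⟩ := h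
    refine ⟨Y, hY1, Set.Subset.antisymm (fun X hX => ?_) (Set.union_subset ?_ hY2)⟩
    · by_cases hfin : X.IsFinite
      · left
        obtain ⟨u, rfl⟩ := exists_toReal_eq hfin
        refine subset_closure ⟨u, toReal_injective ?_, rfl⟩
        rw [← extension_toReal huc]
        exact hX
      · exact hY3 X hX hfin
    · refine closure_minimal ?_ (isClosed_fixedPoints (continuous_extension huc))
      rintro _ ⟨u, hu, rfl⟩
      exact (extension_toReal huc u).trans (congrArg toReal hu)
  -- In a complete graph all letters commute from block 0 on. This case is separate because φ may
  -- then erase some letters and not others.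
  by_cases hcomplete : ∀ a b : A, G.Adj a b ∨ a = b
  · obtain ⟨Y, hY1, _, hY2, hY3⟩ := exists_isMPRational_commutesFrom hG hφ 0
    exact ⟨Y, hY1, hY2, fun X h1 h2 => Or.inr (hY3 X h1 h2 fun _ _ _ _ x _ y _ => hcomplete x y)⟩
  push Not at hcomplete
  obtain ⟨p, q, hpq⟩ := hcomplete
  have hpq' : ¬ (G.Adj p q ∨ p = q) := by rintro (h | h); exacts [hpq.1 h, hpq.2 h]
  by_cases hone : ∃ x, φ (of G x) = 1
  · obtain ⟨x, hx⟩ := hone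
    refine ⟨∅, .finite Set.finite_empty, Set.empty_subset _, fun X h1 h2 => absurd ?_ h2⟩
    have h := extension_eq_one hφ (hφ.map_of_eq_one hG hpq' hx) X
    rw [show extension φ X = X from h1] at h
    rw [h]
    exact isFinite_toReal 1
  push Not at hone
  have hex : ∀ B : {B : {B : Finset A // G.IsClique (B : Set A)} //
      φ (cliqueProd G B.1 B.2) ≠ cliqueProd G B.1 B.2},
      ∃ Y : Set (RealTrace G), IsMPRational Y ∧ Y ⊆ boundary G ∧
        Y ⊆ Function.fixedPoints (extension φ) ∧
        ∀ X ∈ Function.fixedPoints (extension φ), X ∈ boundary G → X.block 0 = B.1.1 → X ∈ Y :=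
    fun B => exists_isMPRational_block_zero hG hφ hone B.1.1 B.1.2 B.2
  choose Y hY1 hY2 hY3 hY4 using hex
  -- A finite union over the nonfixed cliques `B`: a finite fixed point followed by an infinite one
  -- from the set provided for `B`, which contains all those that begin with `B`.
  refine ⟨⋃ B, Set.image2 mixedMul (Function.fixedPoints φ) (Y B),
    .iUnion fun B => .mixed (hY2 B) (isMPRational_fixedPoints hφ hone) (hY1 B), ?_, ?_⟩
  · refine Set.iUnion_subset fun B => ?_
    rintro _ ⟨u, hu, X, hX, rfl⟩
    change extension φ _ = _
    rw [extension_mixedMul hφ, show φ u = u from hu, show extension φ X = X from hY3 B hX]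
  · intro X hX hinf
    refine (mem_closure_or_exists_drop hφ hX).imp_right ?_
    rintro ⟨m, h1, h2, h3⟩
    refine Set.mem_iUnion.2 ⟨⟨⟨_, X.isClique m⟩, h3⟩, X.pre m, h1, X.drop m, ?_,
      mixedMul_pre_drop X m⟩
    refine hY4 _ _ h2 ?_ rfl
    rintro ⟨N, hN⟩
    exact (block_nonempty hinf (m + N)).ne_empty (hN N le_rfl)

end TraceMonoid

/-- The hypothesis `hT` is not used: condition (ii) implies it, and the implication from (i) to (ii)
holds for every finite graph, by a cardinality argument. -/
theorem theorem4p3 {A : Type*} [Finite A] (G : SimpleGraph A) (hT : G.IsTypeT) :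
    List.TFAE [
      ∀ φ : Monoid.End (TraceMonoid G), UniformContinuous φ →
        ∃ Y : Set (RealTrace G), IsMPRational Y ∧
          Function.fixedPoints (TraceMonoid.extension φ) =
            closure (TraceMonoid.toReal '' Function.fixedPoints φ) ∪ Y,
      ∀ a b c : A, (G.Adj a b ∨ a = b) → (G.Adj b c ∨ b = c) → (G.Adj a c ∨ a = c),
      ∃ (n : ℕ) (k : Fin n → ℕ),
        Nonempty (G ≃g disjointUnionComplete fun i => Fin (k i)),
      ∃ (n : ℕ) (k : Fin n → ℕ),
        Nonempty (TraceMonoid G ≃*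
          Monoid.CoprodI fun i => Multiplicative (Fin (k i) →₀ ℕ))] := by
  tfae_have 1 → 2 := TraceMonoid.transitive_of_fixedPoints
  tfae_have 2 → 3 := G.exists_iso_disjointUnionComplete
  tfae_have 3 → 4 := fun ⟨n, k, ⟨e⟩⟩ => ⟨n, k, ⟨TraceMonoid.equivCoprodI e⟩⟩
  tfae_have 4 → 2 := fun ⟨_, _, ⟨e⟩⟩ => TraceMonoid.transitive_of_equivCoprodI e
  tfae_have 2 → 1 := fun h _ hφ => TraceMonoid.exists_fixedPoints_extension_eq h hφ
  tfae_finish
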